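/- Let $\Bbbk$ be a commutative unital ring and let $\mathsf{Mod}_{\Bbbk}$ be the category of $\Bbbk$-modules with the symmetric monoidal structure $(\otimes_{\Bbbk},\Bbbk)$. Let $\mathsf{gr}$ be the category with objects the natural numbers $n$, identified with the free group $\mathsf{F}_n$ on generators $x_1,\dots,x_n$, and with morphisms the group homomorphisms; let $\mathsf{ab}$ be the category of the free abelian groups $\mathbb{Z}^n$, $n\in\mathbb{N}$, and group homomorphisms. The categories $\mathsf{gr}^{\mathsf{op}}$ and $\mathsf{ab}^{\mathsf{op}}$ have finite products (given by the free product $m+n$ and by the direct sum $m+n$, with terminal object $0$), and are regarded as symmetric monoidal categories in this way. For $\mathcal{C}=\mathsf{gr}^{\mathsf{op}}$ or $\mathsf{ab}^{\mathsf{op}}$, let $\mathcal{F}^{\mathsf{exp}}(\mathcal{C};\Bbbk)$ be the category of exponential $\mathcal{C}$-modules, that is, of (strong) symmetric monoidal functors $\mathcal{C}\to\mathsf{Mod}_{\Bbbk}$ and monoidal natural transformations. Let $\mathcal{F}^{\mathsf{exp}}_{\mathsf{out}}(\mathsf{gr}^{\mathsf{op}};\Bbbk)$ be the full subcategory of $\mathcal{F}^{\mathsf{exp}}(\mathsf{gr}^{\mathsf{op}};\Bbbk)$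 of those $F$ that are outer, i.e. such that for every $n$ all inner automorphisms of $\mathsf{F}_n$ act trivially on $F(n)$. Let $\mathsf{Hopf}^{\mathsf{bc}}_{\Bbbk}$ be the category of commutative and cocommutative Hopf algebras over $\Bbbk$. For $F\in\mathcal{F}^{\mathsf{exp}}(\mathsf{gr}^{\mathsf{op}};\Bbbk)$ let $\mathrm{ev}_1(F)$ be the Hopf algebra with underlying module $F(1)$ whose multiplication $F(1)\otimes F(1)\cong F(2)\to F(1)$, unit $\Bbbk\cong F(0)\to F(1)$, comultiplication $F(1)\to F(2)\cong F(1)\otimes F(1)$, counit $F(1)\to F(0)\cong\Bbbk$ and antipode $F(1)\to F(1)$ are induced by the group homomorphisms $\mathsf{F}_1\to\mathsf{F}_2$, $x_1\mapsto x_1x_2$; $\mathsf{F}_1\to\mathsf{F}_0$; $\mathsf{F}_2\to\mathsf{F}_1$, $x_1,x_2\mapsto x_1$; $\mathsf{F}_0\to\mathsf{F}_1$; and $\mathsf{F}_1\to\mathsf{F}_1$, $x_1\mapsto x_1^{-1}$, respectively. Then: (1) Precomposition with the abelianization functor $\mathfrak{a}:\mathsf{gr}\to\mathsf{ab}$ sends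 exponential $\mathsf{ab}^{\mathsf{op}}$-modules to outer exponential $\mathsf{gr}^{\mathsf{op}}$-modules, and the resulting functor $$\mathfrak{a}^*:\mathcal{F}^{\mathsf{exp}}(\mathsf{ab}^{\mathsf{op}};\Bbbk)\to\mathcal{F}^{\mathsf{exp}}_{\mathsf{out}}(\mathsf{gr}^{\mathsf{op}};\Bbbk)$$ is an equivalence of categories. (2) If $F$ is an outer exponential $\mathsf{gr}^{\mathsf{op}}$-module, then the Hopf algebra $\mathrm{ev}_1(F)$ is commutative and cocommutative, and the resulting functor $$\mathrm{ev}_1:\mathcal{F}^{\mathsf{exp}}_{\mathsf{out}}(\mathsf{gr}^{\mathsf{op}};\Bbbk)\to\mathsf{Hopf}^{\mathsf{bc}}_{\Bbbk}$$ is an equivalence of categories. -/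

import Mathlib

open CategoryTheory MonoidalCategory Opposite

universe u

/-! ### The category of finitely generated free groups -/

/-- The skeleton of the category of finitely generated free groups: an object is a natural number
`n`, standing for the free group `F_n` on `n` generators. -/
structure FreeGr : Type where
  /-- The number of generators. -/
  rank : ℕ

namespace FreeGr

/-- The free group `F_n`. -/
abbrev F (n : FreeGr) : Type := FreeGroup (Fin n.rank)

/-- Morphisms `m ⟶ n` are the group homomorphisms `F_m → F_n`. -/
instance : Category FreeGr where
  Hom m n := m.F →* n.F
  id n := MonoidHom.id n.F
  comp f g := g.comp f

/-- A group homomorphism as a morphism of `FreeGr`. -/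
def ofHom {m n : FreeGr} (f : m.F →* n.F) : m ⟶ n := f

/-- The group homomorphism underlying a morphism of `FreeGr`. -/
def hom {m n : FreeGr} (f : m ⟶ n) : m.F →* n.F := f

theorem hom_ext {m n : FreeGr} {f g : m ⟶ n}
    (h : ∀ i, hom f (FreeGroup.of i) = hom g (FreeGroup.of i)) : f = g :=
  FreeGroup.ext_hom _ _ h

/-- The free product `F_m * F_n = F_{m+n}`. -/
abbrev coprod (m n : FreeGr) : FreeGr := ⟨m.rank + n.rank⟩

/-- The inclusion of `F_m` on the first `m` generators of `F_{m+n}`. -/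
def inl (m n : FreeGr) : m ⟶ coprod m n := ofHom (FreeGroup.map (Fin.castAdd n.rank))

/-- The inclusion of `F_n` on the last `n` generators of `F_{m+n}`. -/
def inr (m n : FreeGr) : n ⟶ coprod m n := ofHom (FreeGroup.map (Fin.natAdd m.rank))

/-- The homomorphism out of a free product given by its two components. -/
def desc {m n p : FreeGr} (f : m ⟶ p) (g : n ⟶ p) : coprod m n ⟶ p :=
  ofHom (FreeGroup.lift (Fin.append (fun i => hom f (FreeGroup.of i))
    (fun j => hom g (FreeGroup.of j))))

theorem inl_desc {m n p : FreeGr} (f : m ⟶ p) (g : n ⟶ p) : inl m n ≫ desc f g = f := by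
  refine hom_ext fun i => ?_
  change FreeGroup.lift _ (FreeGroup.map _ (FreeGroup.of i)) = _
  simp

theorem inr_desc {m n p : FreeGr} (f : m ⟶ p) (g : n ⟶ p) : inr m n ≫ desc f g = g := by
  refine hom_ext fun i => ?_
  change FreeGroup.lift _ (FreeGroup.map _ (FreeGroup.of i)) = _
  simp

theorem coprod_hom_ext {m n p : FreeGr} {f g : coprod m n ⟶ p}
    (h₁ : inl m n ≫ f = inl m n ≫ g) (h₂ : inr m n ≫ f = inr m n ≫ g) : f = g := by
  refine hom_ext fun i => Fin.addCases (fun i => ?_) (fun i => ?_) i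
  · have := DFunLike.congr_fun (congrArg hom h₁) (FreeGroup.of i)
    change hom f (FreeGroup.map _ (FreeGroup.of i)) =
      hom g (FreeGroup.map _ (FreeGroup.of i)) at this
    simpa using this
  · have := DFunLike.congr_fun (congrArg hom h₂) (FreeGroup.of i)
    change hom f (FreeGroup.map _ (FreeGroup.of i)) =
      hom g (FreeGroup.map _ (FreeGroup.of i)) at this
    simpa using this

instance (n : FreeGr) : Unique ((⟨0⟩ : FreeGr) ⟶ n) where
  default := ofHom 1
  uniq _ := hom_ext fun i => i.elim0

/-- `gr^op` as a cartesian monoidal category: the product of `m` and `n` is `m + n` (the free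
product of groups), the terminal object is `0` (the trivial group). -/
instance : CartesianMonoidalCategory FreeGrᵒᵖ :=
  .ofChosenFiniteProducts
    ⟨_, Limits.IsTerminal.ofUniqueHom (Y := op (⟨0⟩ : FreeGr))
      (fun X => (default : (⟨0⟩ : FreeGr) ⟶ X.unop).op)
      (fun _ _ => Quiver.Hom.unop_inj (Subsingleton.elim _ _))⟩
    (fun X Y => ⟨Limits.BinaryFan.mk (P := op (coprod X.unop Y.unop))
        (inl X.unop Y.unop).op (inr X.unop Y.unop).op,
      Limits.BinaryFan.IsLimit.mk _ (fun f g => (desc f.unop g.unop).op)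
        (fun f g => Quiver.Hom.unop_inj (inl_desc f.unop g.unop))
        (fun f g => Quiver.Hom.unop_inj (inr_desc f.unop g.unop))
        (fun f g _ h₁ h₂ => Quiver.Hom.unop_inj (coprod_hom_ext
          ((congrArg Quiver.Hom.unop h₁).trans (inl_desc f.unop g.unop).symm)
          ((congrArg Quiver.Hom.unop h₂).trans (inr_desc f.unop g.unop).symm)))⟩)

instance : BraidedCategory FreeGrᵒᵖ := .ofCartesianMonoidalCategory

end FreeGr

/-! ### The category of finitely generated free abelian groups -/

/-- The category of the free abelian groups `ℤ^n`: an object is a natural number `n`. -/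
structure FreeAb : Type where
  /-- The rank. -/
  rank : ℕ

namespace FreeAb

/-- The free abelian group `ℤ^n` on `n` generators. -/
abbrev Z (n : FreeAb) : Type := FreeAbelianGroup (Fin n.rank)

/-- Morphisms `m ⟶ n` are the group homomorphisms `ℤ^m → ℤ^n`. -/
instance : Category FreeAb where
  Hom m n := m.Z →+ n.Z
  id n := AddMonoidHom.id n.Z
  comp f g := g.comp f

/-- A group homomorphism as a morphism of `FreeAb`. -/
def ofHom {m n : FreeAb} (f : m.Z →+ n.Z) : m ⟶ n := f

/-- The group homomorphism underlying a morphism of `FreeAb`. -/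
def hom {m n : FreeAb} (f : m ⟶ n) : m.Z →+ n.Z := f

theorem hom_ext {m n : FreeAb} {f g : m ⟶ n}
    (h : ∀ i, hom f (FreeAbelianGroup.of i) = hom g (FreeAbelianGroup.of i)) : f = g :=
  FreeAbelianGroup.lift_ext _ _ h

/-- The direct sum `ℤ^m ⊕ ℤ^n = ℤ^{m+n}`. -/
abbrev coprod (m n : FreeAb) : FreeAb := ⟨m.rank + n.rank⟩

/-- The inclusion of `ℤ^m` on the first `m` generators of `ℤ^{m+n}`. -/
def inl (m n : FreeAb) : m ⟶ coprod m n := ofHom (FreeAbelianGroup.map (Fin.castAdd n.rank))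

/-- The inclusion of `ℤ^n` on the last `n` generators of `ℤ^{m+n}`. -/
def inr (m n : FreeAb) : n ⟶ coprod m n := ofHom (FreeAbelianGroup.map (Fin.natAdd m.rank))

/-- The homomorphism out of a direct sum given by its two components. -/
def desc {m n p : FreeAb} (f : m ⟶ p) (g : n ⟶ p) : coprod m n ⟶ p :=
  ofHom (FreeAbelianGroup.lift (Fin.append (fun i => hom f (FreeAbelianGroup.of i))
    (fun j => hom g (FreeAbelianGroup.of j))))

theorem inl_desc {m n p : FreeAb} (f : m ⟶ p) (g : n ⟶ p) : inl m n ≫ desc f g = f := by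
  refine hom_ext fun i => ?_
  change FreeAbelianGroup.lift _ (FreeAbelianGroup.map _ (FreeAbelianGroup.of i)) = _
  simp

theorem inr_desc {m n p : FreeAb} (f : m ⟶ p) (g : n ⟶ p) : inr m n ≫ desc f g = g := by
  refine hom_ext fun i => ?_
  change FreeAbelianGroup.lift _ (FreeAbelianGroup.map _ (FreeAbelianGroup.of i)) = _
  simp

theorem coprod_hom_ext {m n p : FreeAb} {f g : coprod m n ⟶ p}
    (h₁ : inl m n ≫ f = inl m n ≫ g) (h₂ : inr m n ≫ f = inr m n ≫ g) : f = g := by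
  refine hom_ext fun i => Fin.addCases (fun i => ?_) (fun i => ?_) i
  · have := DFunLike.congr_fun (congrArg hom h₁) (FreeAbelianGroup.of i)
    change hom f (FreeAbelianGroup.map _ (FreeAbelianGroup.of i)) =
      hom g (FreeAbelianGroup.map _ (FreeAbelianGroup.of i)) at this
    simpa using this
  · have := DFunLike.congr_fun (congrArg hom h₂) (FreeAbelianGroup.of i)
    change hom f (FreeAbelianGroup.map _ (FreeAbelianGroup.of i)) =
      hom g (FreeAbelianGroup.map _ (FreeAbelianGroup.of i)) at this
    simpa using this

instance (n : FreeAb) : Unique ((⟨0⟩ : FreeAb) ⟶ n) where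
  default := ofHom 0
  uniq _ := hom_ext fun i => i.elim0

/-- `ab^op` as a cartesian monoidal category: the product of `m` and `n` is `m + n` (the direct
sum), the terminal object is `0`. -/
instance : CartesianMonoidalCategory FreeAbᵒᵖ :=
  .ofChosenFiniteProducts
    ⟨_, Limits.IsTerminal.ofUniqueHom (Y := op (⟨0⟩ : FreeAb))
      (fun X => (default : (⟨0⟩ : FreeAb) ⟶ X.unop).op)
      (fun _ _ => Quiver.Hom.unop_inj (Subsingleton.elim _ _))⟩
    (fun X Y => ⟨Limits.BinaryFan.mk (P := op (coprod X.unop Y.unop))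
        (inl X.unop Y.unop).op (inr X.unop Y.unop).op,
      Limits.BinaryFan.IsLimit.mk _ (fun f g => (desc f.unop g.unop).op)
        (fun f g => Quiver.Hom.unop_inj (inl_desc f.unop g.unop))
        (fun f g => Quiver.Hom.unop_inj (inr_desc f.unop g.unop))
        (fun f g _ h₁ h₂ => Quiver.Hom.unop_inj (coprod_hom_ext
          ((congrArg Quiver.Hom.unop h₁).trans (inl_desc f.unop g.unop).symm)
          ((congrArg Quiver.Hom.unop h₂).trans (inr_desc f.unop g.unop).symm)))⟩)

instance : BraidedCategory FreeAbᵒᵖ := .ofCartesianMonoidalCategory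

end FreeAb

/-! ### Abelianization -/

section Abelianize

open CartesianMonoidalCategory

/-- The abelianization functor `gr ⥤ ab`, sending `F_n` to `ℤ^n`. (In Mathlib
`FreeAbelianGroup α` is by definition the abelianization of `FreeGroup α`, written additively.) -/
def abelianize : FreeGr ⥤ FreeAb where
  obj n := ⟨n.rank⟩
  map f := FreeAb.ofHom (MonoidHom.toAdditive (Abelianization.map (FreeGr.hom f)))
  map_id n := congrArg MonoidHom.toAdditive (Abelianization.map_id (G := n.F))
  map_comp f g := congrArg MonoidHom.toAdditive
    (Abelianization.map_comp (FreeGr.hom f) (FreeGr.hom g)).symm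

theorem abelianize_prodComparison (X Y : FreeGrᵒᵖ) :
    prodComparison abelianize.op X Y = 𝟙 (abelianize.op.obj (X ⊗ Y)) := by
  apply CartesianMonoidalCategory.hom_ext
  · refine (prodComparison_fst _ _ _).trans (Eq.trans ?_ (Category.id_comp _).symm)
    exact Quiver.Hom.unop_inj (FreeAb.hom_ext fun _ => rfl)
  · refine (prodComparison_snd _ _ _).trans (Eq.trans ?_ (Category.id_comp _).symm)
    exact Quiver.Hom.unop_inj (FreeAb.hom_ext fun _ => rfl)

instance : Limits.PreservesFiniteProducts abelianize.op :=
  have (X Y : FreeGrᵒᵖ) : IsIso (prodComparison abelianize.op X Y) := by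
    rw [abelianize_prodComparison]; exact IsIso.id _
  have : IsIso (terminalComparison abelianize.op) :=
    ⟨𝟙 (𝟙_ FreeAbᵒᵖ), toUnit_unique _ _, toUnit_unique _ _⟩
  have := preservesLimitsOfShape_discrete_walkingPair_of_isIso_prodComparison abelianize.op
  have := preservesLimit_empty_of_isIso_terminalComparison abelianize.op
  have := Limits.preservesLimitsOfShape_pempty_of_preservesTerminal abelianize.op
  .of_preserves_binary_and_terminal _

/-- As a product preserving functor, `gr^op ⥤ ab^op` is symmetric monoidal (in a unique way). -/
noncomputable instance : abelianize.op.Braided := .ofChosenFiniteProducts _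

end Abelianize

/-! ### Exponential functors -/

/-- An exponential `C`-module over `k`: a (strong) symmetric monoidal functor from the category
with finite products `(C, ×, *)` to `(Mod_k, ⊗, k)`. -/
structure ExpFunctor (C : Type) [Category.{0} C] [CartesianMonoidalCategory C]
    [BraidedCategory C] (k : Type u) [CommRing k] where
  /-- The underlying `C`-module. -/
  functor : C ⥤ ModuleCat.{u} k
  /-- The exponential structure `F(X) ⊗ F(Y) ≅ F(X × Y)`, `k ≅ F(*)`. -/
  [braided : functor.Braided]

namespace ExpFunctor

section Category

variable {C : Type} [Category.{0} C] [CartesianMonoidalCategory C] [BraidedCategory C]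
  {k : Type u} [CommRing k]

attribute [instance] ExpFunctor.braided

/-- Morphisms of exponential functors are the monoidal natural transformations. -/
@[ext]
structure Hom (F G : ExpFunctor C k) where
  /-- The underlying natural transformation. -/
  natTrans : F.functor ⟶ G.functor
  [isMonoidal : NatTrans.IsMonoidal natTrans]

attribute [instance] Hom.isMonoidal

/-- The category of exponential `C`-modules. -/
instance : Category (ExpFunctor C k) where
  Hom F G := Hom F G
  id F := { natTrans := 𝟙 F.functor }
  comp f g := { natTrans := f.natTrans ≫ g.natTrans }

theorem app_η {F G : ExpFunctor C k} (f : F ⟶ G) :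
    f.natTrans.app (𝟙_ C) ≫ Functor.OplaxMonoidal.η G.functor =
      Functor.OplaxMonoidal.η F.functor := by
  rw [← cancel_epi (Functor.Monoidal.εIso F.functor).hom]
  simp only [Functor.Monoidal.εIso_hom, Functor.Monoidal.ε_η]
  rw [NatTrans.IsMonoidal.unit_assoc, Functor.Monoidal.ε_η]

theorem app_δ {F G : ExpFunctor C k} (f : F ⟶ G) (X Y : C) :
    f.natTrans.app (X ⊗ Y) ≫ Functor.OplaxMonoidal.δ G.functor X Y =
      Functor.OplaxMonoidal.δ F.functor X Y ≫ (f.natTrans.app X ⊗ₘ f.natTrans.app Y) := by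
  rw [← cancel_epi (Functor.Monoidal.μIso F.functor X Y).hom]
  simp only [Functor.Monoidal.μIso_hom, Functor.Monoidal.μ_δ_assoc]
  rw [NatTrans.IsMonoidal.tensor_assoc, Functor.Monoidal.μ_δ, Category.comp_id]

end Category

/-- Precomposition with abelianization, from exponential `ab^op`-modules to exponential
`gr^op`-modules. -/
noncomputable def abPullback (k : Type u) [CommRing k] :
    ExpFunctor FreeAbᵒᵖ k ⥤ ExpFunctor FreeGrᵒᵖ k where
  obj F := { functor := abelianize.op ⋙ F.functor }
  map f := { natTrans := Functor.whiskerLeft abelianize.op f.natTrans }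

/-- An exponential `gr^op`-module is outer if all inner automorphisms `x ↦ g x g⁻¹` of `F_n` act
trivially on its value at `n`, for every `n`. -/
def IsOuter (k : Type u) [CommRing k] : ObjectProperty (ExpFunctor FreeGrᵒᵖ k) := fun F =>
  ∀ (n : FreeGr) (g : n.F),
    F.functor.map (FreeGr.ofHom (MulAut.conj g).toMonoidHom).op = 𝟙 (F.functor.obj (op n))

end ExpFunctor

/-! ### Transport of Hopf structures -/

namespace HopfTransport

noncomputable section

open scoped MonObj ComonObj TensorProduct
open CartesianMonoidalCategory

/-- A group object in a category with finite products is a Hopf monoid: the comultiplication is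
the diagonal, the counit is the map to the terminal object, the antipode is the inverse. -/
abbrev hopfObjOfGrpObj {C : Type*} [Category* C] [CartesianMonoidalCategory C] [BraidedCategory C]
    (G : C) [GrpObj G] : HopfObj G where
  comul := lift (𝟙 G) (𝟙 G)
  counit := toUnit G
  counit_comul := ComonObj.counit_comul ((cartesianComon C).obj G).X
  comul_counit := ComonObj.comul_counit ((cartesianComon C).obj G).X
  comul_assoc := ComonObj.comul_assoc ((cartesianComon C).obj G).X
  mul_comul := by ext <;> simp
  one_comul := by ext <;> simp [MonObj.tensorObj.one_def]
  mul_counit := toUnit_unique _ _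
  one_counit := toUnit_unique _ _
  antipode := GrpObj.inv
  antipode_left := by simp
  antipode_right := by simp

/-- A symmetric monoidal functor `F` sends a Hopf monoid `A` to a Hopf monoid `F(A)`, with
multiplication `F(A) ⊗ F(A) ≅ F(A ⊗ A) → F(A)`, comultiplication
`F(A) → F(A ⊗ A) ≅ F(A) ⊗ F(A)`, and so on. -/
abbrev mapHopfObj {C : Type*} [Category* C] [MonoidalCategory C] [BraidedCategory C]
    {D : Type*} [Category* D] [MonoidalCategory D] [BraidedCategory D]
    (F : C ⥤ D) [F.Braided] (A : C) [HopfObj A] : HopfObj (F.obj A) where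
  __ := Functor.monObjObj (F := F) A
  __ := Functor.obj.instComonObj A F
  mul_comul := by
    change (Functor.LaxMonoidal.μ F A A ≫ F.map μ[A]) ≫ F.map Δ[A] ≫ Functor.OplaxMonoidal.δ F A A =
      ((F.map Δ[A] ≫ Functor.OplaxMonoidal.δ F A A) ⊗ₘ
        (F.map Δ[A] ≫ Functor.OplaxMonoidal.δ F A A)) ≫
      tensorμ (F.obj A) (F.obj A) (F.obj A) (F.obj A) ≫
      ((Functor.LaxMonoidal.μ F A A ≫ F.map μ[A]) ⊗ₘ (Functor.LaxMonoidal.μ F A A ≫ F.map μ[A]))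
    rw [← cancel_mono (Functor.Monoidal.μIso F A A).hom]
    simp only [Functor.Monoidal.μIso_hom, Category.assoc, Functor.Monoidal.δ_μ, Category.comp_id]
    rw [← tensorHom_comp_tensorHom (Functor.LaxMonoidal.μ F A A), Category.assoc,
      Functor.LaxMonoidal.μ_natural, tensorμ_comp_μ_tensorHom_μ_comp_μ_assoc,
      tensorHom_comp_tensorHom_assoc]
    simp only [Category.assoc, Functor.Monoidal.δ_μ, Category.comp_id]
    rw [Functor.LaxMonoidal.μ_natural_assoc, ← Functor.map_comp, BimonObj.mul_comul]
    simp only [Functor.map_comp]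
  one_comul := by
    change (Functor.LaxMonoidal.ε F ≫ F.map η[A]) ≫ F.map Δ[A] ≫ Functor.OplaxMonoidal.δ F A A =
      (λ_ (𝟙_ D)).inv ≫ ((Functor.LaxMonoidal.ε F ≫ F.map η[A]) ⊗ₘ
        (Functor.LaxMonoidal.ε F ≫ F.map η[A]))
    rw [Category.assoc, ← Functor.map_comp_assoc, BimonObj.one_comul, MonObj.tensorObj.one_def,
      ← cancel_mono (Functor.Monoidal.μIso F A A).hom]
    simp only [Functor.Monoidal.μIso_hom, Category.assoc, Functor.Monoidal.δ_μ, Category.comp_id]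
    rw [← tensorHom_comp_tensorHom (Functor.LaxMonoidal.ε F), Category.assoc,
      Functor.LaxMonoidal.μ_natural, Functor.map_comp,
      MonoidalCategory.tensorHom_def' (Functor.LaxMonoidal.ε F),
      Category.assoc, ← leftUnitor_inv_naturality_assoc,
      Functor.LaxMonoidal.left_unitality_inv_assoc]
  mul_counit := by
    change (Functor.LaxMonoidal.μ F A A ≫ F.map μ[A]) ≫ F.map ε[A] ≫ Functor.OplaxMonoidal.η F =
      ((F.map ε[A] ≫ Functor.OplaxMonoidal.η F) ⊗ₘ (F.map ε[A] ≫ Functor.OplaxMonoidal.η F)) ≫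
        (λ_ (𝟙_ D)).hom
    rw [Category.assoc, ← Functor.map_comp_assoc, BimonObj.mul_counit, Comon.tensorObj_counit]
    rw [← cancel_epi (Functor.Monoidal.μIso F A A).inv]
    simp only [Functor.Monoidal.μIso_inv, Functor.Monoidal.δ_μ_assoc]
    rw [← tensorHom_comp_tensorHom (F.map ε[A]), Category.assoc,
      Functor.OplaxMonoidal.δ_natural_assoc, Functor.map_comp, Category.assoc,
      MonoidalCategory.tensorHom_def (Functor.OplaxMonoidal.η F), Category.assoc,
      leftUnitor_naturality, Functor.OplaxMonoidal.left_unitality_hom_assoc]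
  one_counit := by simp [← Functor.map_comp_assoc]
  antipode := F.map HopfObj.antipode
  antipode_left := by
    have := congrArg F.map (HopfObj.antipode_left A)
    simp only [Functor.map_comp] at this
    simp [this]
  antipode_right := by
    have := congrArg F.map (HopfObj.antipode_right A)
    simp only [Functor.map_comp] at this
    simp [this]

variable {k : Type u} [CommRing k]

open ModuleCat.MonModuleEquivalenceAlgebra

theorem tensor_mul_eq (A : ModuleCat.{u} k) [MonObj A] (s t : (A ⊗[k] A : Type u)) :
    s * t = (tensorμ A A A A ≫ (μ[A] ⊗ₘ μ[A])).hom (s ⊗ₜ[k] t) := by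
  induction s with
  | zero => simp
  | add x y hx hy => rw [add_mul, TensorProduct.add_tmul, map_add, hx, hy]
  | tmul a b =>
    induction t with
    | zero => simp
    | add x y hx hy => rw [mul_add, TensorProduct.tmul_add, map_add, hx, hy]
    | tmul c d => rw [Algebra.TensorProduct.tmul_mul_tmul]; rfl

theorem linearMap_mul_eq (A : ModuleCat.{u} k) [MonObj A] : LinearMap.mul' k A = μ[A].hom :=
  TensorProduct.ext' fun _ _ => rfl

/-- A Hopf monoid in `Mod_k` is a Hopf algebra over `k` with the same structure maps; the
underlying `k`-algebra is Mathlib's algebra of a monoid object of `Mod_k`, with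
`x * y = μ (x ⊗ y)` and `1 = η 1`. -/
abbrev hopfAlgebraOfHopfObj (A : ModuleCat.{u} k) [HopfObj A] : HopfAlgebra k A where
  comul := Δ[A].hom
  counit := ε[A].hom
  coassoc := ModuleCat.hom_ext_iff.mp (ComonObj.comul_assoc A).symm
  rTensor_counit_comp_comul := ModuleCat.hom_ext_iff.mp (ComonObj.counit_comul A)
  lTensor_counit_comp_comul := ModuleCat.hom_ext_iff.mp (ComonObj.comul_counit A)
  counit_one := LinearMap.congr_fun (ModuleCat.hom_ext_iff.mp (BimonObj.one_counit A)) (1 : k)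
  mul_compr₂_counit := LinearMap.ext₂ fun a b =>
    LinearMap.congr_fun (ModuleCat.hom_ext_iff.mp (BimonObj.mul_counit A)) (a ⊗ₜ b)
  comul_one := LinearMap.congr_fun (ModuleCat.hom_ext_iff.mp (BimonObj.one_comul A)) (1 : k)
  mul_compr₂_comul := LinearMap.ext₂ fun a b =>
    (LinearMap.congr_fun (ModuleCat.hom_ext_iff.mp (BimonObj.mul_comul A)) (a ⊗ₜ b)).trans
      (tensor_mul_eq A _ _).symm
  antipode := (HopfObj.antipode (X := A)).hom
  mul_antipode_rTensor_comul := by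
    rw [linearMap_mul_eq]
    exact ModuleCat.hom_ext_iff.mp (HopfObj.antipode_left A)
  mul_antipode_lTensor_comul := by
    rw [linearMap_mul_eq]
    exact ModuleCat.hom_ext_iff.mp (HopfObj.antipode_right A)

end

end HopfTransport

/-! ### Evaluation at `F_1` -/

namespace FreeGr

/-- The object `1`, that is, the free group `F_1`. -/
abbrev one : FreeGr := ⟨1⟩

theorem one_hom_ext {n : FreeGr} {f g : one ⟶ n}
    (h : hom f (FreeGroup.of (0 : Fin 1)) = hom g (FreeGroup.of (0 : Fin 1))) : f = g :=
  hom_ext fun i => by rw [Subsingleton.elim i (0 : Fin 1)]; exact h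

/-- The morphism `2 ⟶ 1` of `gr^op` given by `F_1 → F_2`, `x₁ ↦ x₁ x₂`. -/
def nabla : op (⟨2⟩ : FreeGr) ⟶ op one :=
  (ofHom (FreeGroup.lift fun _ => FreeGroup.of (0 : Fin 2) * FreeGroup.of (1 : Fin 2))).op

/-- The morphism `0 ⟶ 1` of `gr^op` given by the trivial map `F_1 → F_0`. -/
def unit : op (⟨0⟩ : FreeGr) ⟶ op one := (ofHom 1).op

/-- The morphism `1 ⟶ 1` of `gr^op` given by `F_1 → F_1`, `x₁ ↦ x₁⁻¹`. -/
def gamma : op one ⟶ op one :=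
  (ofHom (FreeGroup.lift fun _ => (FreeGroup.of (0 : Fin 1))⁻¹)).op

/-- The canonical group object structure on `1` in `gr^op`. Its diagonal `1 ⟶ 2` is the fold map
`F_2 → F_1`, `x₁, x₂ ↦ x₁`. -/
instance : GrpObj (op FreeGr.one) where
  one := unit
  mul := nabla
  inv := gamma
  one_mul := Quiver.Hom.unop_inj (one_hom_ext rfl)
  mul_one := Quiver.Hom.unop_inj (one_hom_ext rfl)
  mul_assoc := Quiver.Hom.unop_inj (one_hom_ext rfl)
  left_inv := Quiver.Hom.unop_inj (one_hom_ext (inv_mul_cancel (FreeGroup.of (0 : Fin 1))))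
  right_inv := Quiver.Hom.unop_inj (one_hom_ext (mul_inv_cancel (FreeGroup.of (0 : Fin 1))))

end FreeGr

namespace ExpFunctor

noncomputable section

variable {k : Type u} [CommRing k]

open CartesianMonoidalCategory HopfTransport
open ModuleCat.MonModuleEquivalenceAlgebra
open scoped TensorProduct

/-- The Hopf monoid structure on `F(1)` induced by the group object `1` of `gr^op`. -/
abbrev hopfObj (F : ExpFunctor FreeGrᵒᵖ k) : HopfObj (F.functor.obj (op FreeGr.one)) :=
  letI : HopfObj (op FreeGr.one) := hopfObjOfGrpObj (op FreeGr.one)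
  mapHopfObj F.functor (op FreeGr.one)

/-- The Hopf algebra `F(1)` of an exponential `gr^op`-module `F`. -/
def ev₁Obj (F : ExpFunctor FreeGrᵒᵖ k) : HopfAlgCat.{u} k :=
  letI := F.hopfObj
  letI := hopfAlgebraOfHopfObj (F.functor.obj (op FreeGr.one))
  HopfAlgCat.of k (F.functor.obj (op FreeGr.one))

theorem isBimonHom {F G : ExpFunctor FreeGrᵒᵖ k} (f : F ⟶ G) :
    letI := F.hopfObj
    letI := G.hopfObj
    IsBimonHom (f.natTrans.app (op FreeGr.one)) :=
  letI := F.hopfObj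
  letI := G.hopfObj
  { one_hom := by
      change (Functor.LaxMonoidal.ε F.functor ≫ F.functor.map FreeGr.unit) ≫ _ =
        Functor.LaxMonoidal.ε G.functor ≫ G.functor.map FreeGr.unit
      rw [Category.assoc, f.natTrans.naturality]
      exact NatTrans.IsMonoidal.unit_assoc (τ := f.natTrans) _
    mul_hom := by
      change (Functor.LaxMonoidal.μ F.functor (op FreeGr.one) (op FreeGr.one) ≫
          F.functor.map FreeGr.nabla) ≫ _ =
        _ ≫ Functor.LaxMonoidal.μ G.functor (op FreeGr.one) (op FreeGr.one) ≫
          G.functor.map FreeGr.nabla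
      rw [Category.assoc, f.natTrans.naturality]
      exact NatTrans.IsMonoidal.tensor_assoc (τ := f.natTrans) _ _ _
    hom_counit := by
      change _ ≫ G.functor.map (toUnit _) ≫ Functor.OplaxMonoidal.η G.functor =
        F.functor.map (toUnit _) ≫ Functor.OplaxMonoidal.η F.functor
      rw [← f.natTrans.naturality_assoc, app_η]
    hom_comul := by
      change _ ≫ G.functor.map (lift (𝟙 _) (𝟙 _)) ≫ Functor.OplaxMonoidal.δ G.functor _ _ =
        (F.functor.map (lift (𝟙 _) (𝟙 _)) ≫ Functor.OplaxMonoidal.δ F.functor _ _) ≫ _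
      rw [← f.natTrans.naturality_assoc, app_δ, Category.assoc] }

/-- The homomorphism `F(1) → G(1)` of Hopf algebras induced by a morphism of exponential
`gr^op`-modules: its component at `1`. -/
def ev₁Map {F G : ExpFunctor FreeGrᵒᵖ k} (f : F ⟶ G) : F.ev₁Obj →ₐc[k] G.ev₁Obj :=
  letI := F.hopfObj
  letI := G.hopfObj
  letI := isBimonHom f
  { (f.natTrans.app (op FreeGr.one)).hom with
    counit_comp := ModuleCat.hom_ext_iff.mp
      (IsComonHom.hom_counit (f.natTrans.app (op FreeGr.one)))
    map_comp_comul := ModuleCat.hom_ext_iff.mp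
      (IsComonHom.hom_comul (f.natTrans.app (op FreeGr.one))).symm
    map_one' := LinearMap.congr_fun (ModuleCat.hom_ext_iff.mp
      (IsMonHom.one_hom (f.natTrans.app (op FreeGr.one)))) (1 : k)
    map_mul' := fun x y => LinearMap.congr_fun (ModuleCat.hom_ext_iff.mp
      (IsMonHom.mul_hom (f.natTrans.app (op FreeGr.one)))) (x ⊗ₜ[k] y) }

/-- Evaluation at `F_1`, from exponential `gr^op`-modules to Hopf algebras. -/
def ev₁ (k : Type u) [CommRing k] : ExpFunctor FreeGrᵒᵖ k ⥤ HopfAlgCat.{u} k where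
  obj F := F.ev₁Obj
  map f := ⟨ev₁Map f⟩
  map_id _ := rfl
  map_comp _ _ := rfl

end

end ExpFunctor

/-- A Hopf algebra is bicommutative if it is commutative and cocommutative. -/
def HopfAlgCat.IsBicommutative (k : Type u) [CommRing k] : ObjectProperty (HopfAlgCat.{u} k) :=
  fun H => (∀ x y : H, x * y = y * x) ∧ Coalgebra.IsCocomm k H

/-! In a symmetric monoidal category `D` the cocommutative comonoids form a category whose tensor
product is the categorical product. Every object of a category with finite products is a
cocommutative comonoid by its diagonal, so a symmetric monoidal functor from such a category to `D`
lifts to a product preserving functor into cocommutative comonoids (`toCocommComon`). Monoidal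
transformations are exactly the natural transformations whose components are comonoid morphisms.

In `gr^op` the object `n` is the `n`-th power of `1`, hence `F(n)` is the `n`-th power of `F(1)`
among cocommutative comonoids. A monoidal transformation is therefore determined by its component at
`1`, and a Hopf morphism `F(1) ⟶ G(1)` extends to all `n`; naturality is an induction on words
(`comp_map_elt`). So `ev₁` is fully faithful, even without the outer condition.

Cocommutativity of `F(1)` is automatic. If `F` is outer, `F(1)` is also commutative, because `x₁x₂`
and `x₂x₁` are conjugate in `F_2`. Precomposition with abelianization is fully faithful, because
abelianization is full, bijective on objects and strictly monoidal.

For essential surjectivity, a bicommutative Hopf algebra `H` is a commutative group object among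
cocommutative comonoids. Its powers form a product preserving functor on `ab^op` (`powFunctor`);
forgetting comonoid structures and restricting to `gr^op` gives an outer functor with value `H` at
`1` (`ev₁Iso`). This settles (2). For (1), an outer `F` and the functor built from `ev₁ F` agree
after `ev₁`, hence are isomorphic by full faithfulness. -/

/-! ### Cocommutative comonoids form a cartesian monoidal category -/

namespace CategoryTheory

open ComonObj Limits

variable {D : Type*} [Category* D] [MonoidalCategory D]

namespace ComonObj

/-- Coassociativity brackets the fourfold comultiplication so that its two middle factors come from
a single `Δ`; a swap of these factors is then absorbed by cocommutativity. -/
theorem comul_tensorHom_comul (A : D) [ComonObj A] : Δ[A] ≫ (Δ[A] ⊗ₘ Δ[A]) =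
    Δ[A] ≫ A ◁ (Δ[A] ≫ Δ[A] ▷ A ≫ (α_ _ _ _).hom) ≫ (α_ _ _ _).inv := by
  rw [MonoidalCategory.tensorHom_def, comul_assoc_flip_assoc, ← associator_inv_naturality_right,
    ← MonoidalCategory.whiskerLeft_comp_assoc, comul_assoc]

theorem comul_tensorHom_fst {A B C : D} [ComonObj A] [ComonObj C] (f : A ⟶ B) (g : A ⟶ C)
    [IsComonHom g] : (Δ[A] ≫ (f ⊗ₘ g)) ≫ B ◁ ε[C] ≫ (ρ_ B).hom = f := by
  rw [Category.assoc, tensorHom_comp_whiskerLeft_assoc, IsComonHom.hom_counit,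
    comul_counit_hom_assoc, Iso.inv_hom_id, Category.comp_id]

theorem comul_tensorHom_snd {A B C : D} [ComonObj A] [ComonObj B] (f : A ⟶ B) (g : A ⟶ C)
    [IsComonHom f] : (Δ[A] ≫ (f ⊗ₘ g)) ≫ ε[B] ▷ C ≫ (λ_ C).hom = g := by
  rw [Category.assoc, tensorHom_comp_whiskerRight_assoc, IsComonHom.hom_counit,
    counit_comul_hom_assoc, Iso.inv_hom_id, Category.comp_id]

variable [SymmetricCategory D]

/-- The comultiplication of a cocommutative comonoid is a morphism of comonoids. -/
instance isComonHom_comul (A : D) [ComonObj A] [IsCommComonObj A] : IsComonHom Δ[A] where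
  hom_counit := by
    rw [Comon.tensorObj_counit, counit_comul_hom_assoc, Iso.inv_hom_id, Category.comp_id]
  hom_comul := by
    rw [Comon.tensorObj_comul, ← Category.assoc, comul_tensorHom_comul, tensorμ]
    simp only [Category.assoc, Iso.inv_hom_id_assoc]
    simp only [← MonoidalCategory.whiskerLeft_comp_assoc, Category.assoc,
      Iso.hom_inv_id_assoc]
    -- The middle braiding of `tensorμ` now follows the inner `Δ` directly.
    rw [← comp_whiskerRight_assoc, IsCommComonObj.comul_comm]

theorem tensorμ_tensorUnit_tensorUnit (A B : D) :
    ((ρ_ A).inv ⊗ₘ (λ_ B).inv) ≫ tensorμ A (𝟙_ D) (𝟙_ D) B ≫ ((ρ_ A).hom ⊗ₘ (λ_ B).hom) =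
      𝟙 (A ⊗ B) := by
  simp only [tensorμ, braiding_tensorUnit_left]
  monoidal

/-- This is the uniqueness half of the product property: by the counit laws, copying and then
projecting to both factors loses nothing. -/
theorem comul_tensorObj_proj (A B : D) [ComonObj A] [ComonObj B] :
    Δ[A ⊗ B] ≫ (A ◁ ε[B] ≫ (ρ_ A).hom ⊗ₘ ε[A] ▷ B ≫ (λ_ B).hom) = 𝟙 (A ⊗ B) := by
  rw [Comon.tensorObj_comul, Category.assoc, ← tensorHom_comp_tensorHom,
    ← id_tensorHom, ← tensorHom_id, ← tensorμ_natural_assoc, tensorHom_comp_tensorHom_assoc,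
    comul_counit_hom, counit_comul_hom, Category.id_comp, Category.id_comp,
    tensorμ_tensorUnit_tensorUnit]

theorem comul_tensorHom_proj {T A B : D} [ComonObj T] [ComonObj A] [ComonObj B]
    (m : T ⟶ A ⊗ B) [IsComonHom m] :
    Δ[T] ≫ (m ≫ A ◁ ε[B] ≫ (ρ_ A).hom ⊗ₘ m ≫ ε[A] ▷ B ≫ (λ_ B).hom) = m := by
  rw [← tensorHom_comp_tensorHom, ← IsComonHom.hom_comul_assoc, comul_tensorObj_proj,
    Category.comp_id]

end ComonObj

variable [SymmetricCategory D]

variable (D) in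
/-- The property of a comonoid to be cocommutative. -/
def Comon.isCocomm : ObjectProperty (Comon D) := fun A => IsCommComonObj A.X

instance : (Comon.isCocomm D).IsMonoidal where
  prop_unit := CommComon.instCommComonObjUnit (C := D)
  prop_tensor A B hA hB := by
    have : IsCommComonObj A.X := hA
    have : IsCommComonObj B.X := hB
    exact inferInstanceAs (IsCommComonObj (A.X ⊗ B.X))

variable (D) in
/-- The category of cocommutative comonoids, with the monoidal structure of the category of
comonoids. -/
abbrev CocommComon := (Comon.isCocomm D).FullSubcategory

namespace CocommComon

instance (A : CocommComon D) : IsCommComonObj A.obj.X := A.property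

/-- A cocommutative comonoid object as an object of `CocommComon D`. -/
abbrev of (A : D) [ComonObj A] [h : IsCommComonObj A] : CocommComon D := ⟨⟨A⟩, h⟩

/-- A morphism of comonoids between cocommutative comonoids. -/
abbrev ofHom {A B : CocommComon D} (f : A.obj.X ⟶ B.obj.X) (_ : IsComonHom f) : A ⟶ B :=
  ObjectProperty.homMk ⟨f⟩

theorem hom_ext {A B : CocommComon D} {f g : A ⟶ B} (h : f.hom.hom = g.hom.hom) : f = g :=
  ObjectProperty.hom_ext _ (Comon.ext h)

/-- The unit is terminal in the category of cocommutative comonoids. -/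
def isTerminalUnit : IsTerminal (𝟙_ (CocommComon D)) :=
  IsTerminal.ofUniqueHom (fun A => ObjectProperty.homMk (default : A.obj ⟶ Comon.trivial D))
    (fun A _ => ObjectProperty.hom_ext _ (Subsingleton.elim (α := A.obj ⟶ Comon.trivial D) _ _))

/-- The morphism of cocommutative comonoids into a tensor product given by its components. -/
def pair {T A B : CocommComon D} (f : T ⟶ A) (g : T ⟶ B) : T ⟶ A ⊗ B :=
  ObjectProperty.homMk (Y := T ⊗ T) (Comon.Hom.mk (N := T.obj ⊗ T.obj) Δ[T.obj.X]
    (isComonHom_hom := isComonHom_comul T.obj.X)) ≫ (f ⊗ₘ g)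

theorem whiskerLeft_from_rightUnitor_hom (A B : CocommComon D) :
    (A ◁ isTerminalUnit.from B ≫ (ρ_ A).hom).hom.hom =
      A.obj.X ◁ ε[B.obj.X] ≫ (ρ_ A.obj.X).hom := by
  -- The unitor of comonoids unfolds to that of `D` preceded by a whiskered identity.
  have h : A.obj.X ◁ 𝟙 (𝟙_ D) ≫ (ρ_ A.obj.X).hom = (ρ_ A.obj.X).hom := by simp
  simp
  exact congrArg (A.obj.X ◁ ε[B.obj.X] ≫ ·) h

theorem from_whiskerRight_leftUnitor_hom (A B : CocommComon D) :
    (isTerminalUnit.from A ▷ B ≫ (λ_ B).hom).hom.hom =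
      ε[A.obj.X] ▷ B.obj.X ≫ (λ_ B.obj.X).hom := by
  have h : 𝟙 (𝟙_ D) ▷ B.obj.X ≫ (λ_ B.obj.X).hom = (λ_ B.obj.X).hom := by simp
  simp
  exact congrArg (ε[A.obj.X] ▷ B.obj.X ≫ ·) h

instance : CartesianMonoidalCategory (CocommComon D) where
  isTerminalTensorUnit := isTerminalUnit
  fst A B := A ◁ isTerminalUnit.from B ≫ (ρ_ A).hom
  snd A B := isTerminalUnit.from A ▷ B ≫ (λ_ B).hom
  tensorProductIsBinaryProduct A B := BinaryFan.IsLimit.mk _ pair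
    (fun f g => hom_ext
      ((congrArg ((pair f g).hom.hom ≫ ·) (whiskerLeft_from_rightUnitor_hom A B)).trans
        (comul_tensorHom_fst f.hom.hom g.hom.hom)))
    (fun f g => hom_ext
      ((congrArg ((pair f g).hom.hom ≫ ·) (from_whiskerRight_leftUnitor_hom A B)).trans
        (comul_tensorHom_snd f.hom.hom g.hom.hom)))
    (fun {T} f g m hf hg => by
      subst hf hg
      refine hom_ext ?_
      change m.hom.hom = Δ[T.obj.X] ≫
        (m.hom.hom ≫ (A ◁ isTerminalUnit.from B ≫ (ρ_ A).hom).hom.hom ⊗ₘ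
          m.hom.hom ≫ (isTerminalUnit.from A ▷ B ≫ (λ_ B).hom).hom.hom)
      rw [whiskerLeft_from_rightUnitor_hom, from_whiskerRight_leftUnitor_hom]
      have : IsComonHom (N := A.obj.X ⊗ B.obj.X) m.hom.hom := m.hom.isComonHom_hom
      exact (comul_tensorHom_proj (A := A.obj.X) (B := B.obj.X) m.hom.hom).symm)

open CartesianMonoidalCategory

theorem fst_hom (A B : CocommComon D) :
    (fst A B).hom.hom = A.obj.X ◁ ε[B.obj.X] ≫ (ρ_ A.obj.X).hom :=
  whiskerLeft_from_rightUnitor_hom A B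

theorem snd_hom (A B : CocommComon D) :
    (snd A B).hom.hom = ε[A.obj.X] ▷ B.obj.X ≫ (λ_ B.obj.X).hom :=
  from_whiskerRight_leftUnitor_hom A B

instance : BraidedCategory (CocommComon D) := .ofCartesianMonoidalCategory

/-- The braiding on the left is built from the product projections, so agreement with `D` is not
definitional. Since `A ⊗ B` is cocommutative, a braiding can be inserted after `Δ` and moved past
the two projections, which then cancel by `comul_tensorObj_proj`. -/
theorem braiding_hom_hom (A B : CocommComon D) :
    (β_ A B).hom.hom.hom = (β_ A.obj.X B.obj.X).hom := by
  change Δ[A.obj.X ⊗ B.obj.X] ≫ ((snd A B).hom.hom ⊗ₘ (fst A B).hom.hom) = _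
  rw [fst_hom, snd_hom]
  rw [← IsCommComonObj.comul_comm, Category.assoc, ← BraidedCategory.braiding_naturality,
    reassoc_of% comul_tensorObj_proj A.obj.X B.obj.X]

variable (D) in
/-- The forgetful functor from cocommutative comonoids. -/
abbrev forget : CocommComon D ⥤ D := (Comon.isCocomm D).ι ⋙ Comon.forget D

instance : (forget D).Braided where
  braided A B := by
    change (𝟙 _ ≫ 𝟙 _) ≫ (β_ A B).hom.hom.hom = (β_ A.obj.X B.obj.X).hom ≫ 𝟙 _ ≫ 𝟙 _
    rw [braiding_hom_hom, Category.comp_id, Category.comp_id]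
    exact (Category.id_comp (β_ A.obj.X B.obj.X).hom).trans (Category.comp_id _).symm

theorem forget_ε : Functor.LaxMonoidal.ε (forget D) = 𝟙 (𝟙_ D) :=
  Category.comp_id (𝟙 (𝟙_ D))

theorem forget_μ (A B : CocommComon D) :
    Functor.LaxMonoidal.μ (forget D) A B = 𝟙 (A.obj.X ⊗ B.obj.X) :=
  Category.comp_id (𝟙 (A.obj.X ⊗ B.obj.X))

theorem forget_η : Functor.OplaxMonoidal.η (forget D) = 𝟙 (𝟙_ D) :=
  Category.comp_id (𝟙 (𝟙_ D))

theorem forget_δ (A B : CocommComon D) :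
    Functor.OplaxMonoidal.δ (forget D) A B = 𝟙 (A.obj.X ⊗ B.obj.X) :=
  Category.comp_id (𝟙 (A.obj.X ⊗ B.obj.X))

end CocommComon

end CategoryTheory

/-! ### Lifting braided functors to cocommutative comonoids -/

namespace CategoryTheory.Functor

open CartesianMonoidalCategory LaxMonoidal OplaxMonoidal

variable {C : Type*} [Category* C] [CartesianMonoidalCategory C] [BraidedCategory C]
  {D : Type*} [Category* D] [MonoidalCategory D] [SymmetricCategory D]

/-- The comonoid structure on the value of a braided functor on a cartesian monoidal category,
induced by the diagonal. -/
abbrev diagComonObj (F : C ⥤ D) [F.Braided] (X : C) : ComonObj (F.obj X) :=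
  ((cartesianComon C ⋙ F.mapComon).obj X).comon

attribute [local instance] diagComonObj

theorem diag_comul (F : C ⥤ D) [F.Braided] (X : C) :
    ComonObj.comul (X := F.obj X) = F.map (lift (𝟙 X) (𝟙 X)) ≫ δ F X X := rfl

theorem diag_counit (F : C ⥤ D) [F.Braided] (X : C) :
    ComonObj.counit (X := F.obj X) = F.map (toUnit X) ≫ η F := rfl

/-- A diagonal is invariant under the swap, and `F` respects braidings. -/
instance isCommComonObj_obj (F : C ⥤ D) [F.Braided] (X : C) : IsCommComonObj (F.obj X) where
  comul_comm := by
    rw [diag_comul, Category.assoc]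
    have h : δ F X X ≫ (β_ (F.obj X) (F.obj X)).hom = F.map (β_ X X).hom ≫ δ F X X := by
      simp [Functor.map_braiding]
    rw [h, ← F.map_comp_assoc, lift_braiding_hom]

theorem map_lift_δ (F : C ⥤ D) [F.Braided] {T X Y : C} (f : T ⟶ X) (g : T ⟶ Y) :
    F.map (lift f g) ≫ δ F X Y = ComonObj.comul ≫ (F.map f ⊗ₘ F.map g) := by
  rw [diag_comul, Category.assoc, δ_natural, ← F.map_comp_assoc, lift_map, Category.id_comp,
    Category.id_comp]

/-- The monoidal structure of `F` can be recovered from the comonoids `F(X)`: `δ` is the pairing of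
the images of the projections. This is why comonoid morphisms suffice for monoidality. -/
theorem δ_eq_comul (F : C ⥤ D) [F.Braided] (X Y : C) :
    δ F X Y = ComonObj.comul ≫ (F.map (fst X Y) ⊗ₘ F.map (snd X Y)) := by
  rw [← map_lift_δ, lift_fst_snd, F.map_id, Category.id_comp]

theorem η_eq_counit (F : C ⥤ D) [F.Braided] :
    η F = ComonObj.counit (X := F.obj (𝟙_ C)) := by
  rw [diag_counit, toUnit_unit, F.map_id, Category.id_comp]

/-- A braided functor on a cartesian monoidal category takes values in cocommutative comonoids. -/
def toCocommComon (F : C ⥤ D) [F.Braided] : C ⥤ CocommComon D :=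
  (Comon.isCocomm D).lift (cartesianComon C ⋙ F.mapComon) (isCommComonObj_obj F)

theorem prodComparison_toCocommComon_hom (F : C ⥤ D) [F.Braided] (X Y : C) :
    (prodComparison F.toCocommComon X Y).hom.hom = δ F X Y :=
  (δ_eq_comul F X Y).symm

theorem terminalComparison_toCocommComon_hom (F : C ⥤ D) [F.Braided] :
    (terminalComparison F.toCocommComon).hom.hom = η F :=
  (η_eq_counit F).symm

/-- The comparison morphisms have the invertible maps `δ` and `η` underneath, and forgetting the
comonoid structure reflects isomorphisms. -/
instance preservesFiniteProducts_toCocommComon (F : C ⥤ D) [F.Braided] :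
    Limits.PreservesFiniteProducts F.toCocommComon :=
  have (X Y : C) : IsIso (prodComparison F.toCocommComon X Y) := by
    have : IsIso ((CocommComon.forget D).map (prodComparison F.toCocommComon X Y)) := by
      change IsIso (prodComparison F.toCocommComon X Y).hom.hom
      exact prodComparison_toCocommComon_hom F X Y ▸ inferInstanceAs (IsIso (δ F X Y))
    exact isIso_of_reflects_iso _ (CocommComon.forget D)
  have : IsIso (terminalComparison F.toCocommComon) := by
    have : IsIso ((CocommComon.forget D).map (terminalComparison F.toCocommComon)) := by
      change IsIso (terminalComparison F.toCocommComon).hom.hom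
      exact terminalComparison_toCocommComon_hom F ▸ inferInstanceAs (IsIso (η F))
    exact isIso_of_reflects_iso _ (CocommComon.forget D)
  have := preservesLimitsOfShape_discrete_walkingPair_of_isIso_prodComparison F.toCocommComon
  have := preservesLimit_empty_of_isIso_terminalComparison F.toCocommComon
  have := Limits.preservesLimitsOfShape_pempty_of_preservesTerminal F.toCocommComon
  .of_preserves_binary_and_terminal _

/-- The components of a monoidal transformation are morphisms of comonoids. -/
theorem isComonHom_app {F G : C ⥤ D} [F.Braided] [G.Braided] (τ : F ⟶ G) [NatTrans.IsMonoidal τ]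
    (X : C) : IsComonHom (τ.app X) where
  hom_counit := by
    rw [diag_counit, diag_counit, ← τ.naturality_assoc]
    congr 1
    rw [← cancel_epi (Monoidal.εIso F).hom]
    simp only [Monoidal.εIso_hom, Monoidal.ε_η]
    rw [NatTrans.IsMonoidal.unit_assoc, Monoidal.ε_η]
  hom_comul := by
    rw [diag_comul, diag_comul, ← τ.naturality_assoc, Category.assoc]
    congr 1
    rw [← cancel_epi (Monoidal.μIso F X X).hom]
    simp only [Monoidal.μIso_hom, Monoidal.μ_δ_assoc]
    rw [NatTrans.IsMonoidal.tensor_assoc, Monoidal.μ_δ, Category.comp_id]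

/-- A natural transformation whose components are morphisms of comonoids is monoidal. -/
theorem isMonoidal_of_isComonHom_app {F G : C ⥤ D} [F.Braided] [G.Braided] (τ : F ⟶ G)
    (h : ∀ X, IsComonHom (τ.app X)) : NatTrans.IsMonoidal τ where
  unit := by
    have := h (𝟙_ C)
    rw [← cancel_mono (Monoidal.εIso G).inv]
    simp only [Monoidal.εIso_inv, Category.assoc, Monoidal.ε_η]
    rw [η_eq_counit, IsComonHom.hom_counit, ← η_eq_counit, Monoidal.ε_η]
  tensor X Y := by
    have := h (X ⊗ Y)
    rw [← cancel_mono (Monoidal.μIso G X Y).inv, ← cancel_epi (Monoidal.μIso F X Y).inv]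
    simp only [Monoidal.μIso_inv, Category.assoc, Monoidal.δ_μ_assoc, Monoidal.μ_δ,
      Category.comp_id]
    rw [δ_eq_comul, δ_eq_comul, IsComonHom.hom_comul_assoc, Category.assoc,
      tensorHom_comp_tensorHom, tensorHom_comp_tensorHom, τ.naturality, τ.naturality]

end CategoryTheory.Functor

/-! ### Transformations of braided functors on `gr^op` -/

namespace FreeGr

open CartesianMonoidalCategory

/-- The morphism `n ⟶ 1` of `gr^op` given by an element of `F_n`. -/
def elt {n : FreeGr} (w : n.F) : op n ⟶ op one := (ofHom (FreeGroup.lift fun _ => w)).op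

theorem hom_unop_elt {n : FreeGr} (w : n.F) (i : Fin 1) :
    hom (elt w).unop (FreeGroup.of i) = w := FreeGroup.lift_apply_of

theorem elt_one (n : FreeGr) : elt (1 : n.F) = toUnit (op n) ≫ MonObj.one :=
  Quiver.Hom.unop_inj (one_hom_ext rfl)

theorem elt_mul {n : FreeGr} (v w : n.F) :
    elt (v * w) = lift (elt v) (elt w) ≫ MonObj.mul := by
  refine Quiver.Hom.unop_inj (one_hom_ext ?_)
  have h₁ := DFunLike.congr_fun (congrArg hom (inl_desc (elt v).unop (elt w).unop))
    (FreeGroup.of (0 : Fin 1))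
  have h₂ := DFunLike.congr_fun (congrArg hom (inr_desc (elt v).unop (elt w).unop))
    (FreeGroup.of (0 : Fin 1))
  rw [hom_unop_elt] at h₁ h₂ ⊢
  refine (congrArg₂ (· * ·) h₁ h₂).symm.trans ?_
  exact (map_mul (hom (desc (elt v).unop (elt w).unop)) (FreeGroup.of (0 : Fin 2))
    (FreeGroup.of (1 : Fin 2))).symm.trans (congrArg _ FreeGroup.lift_apply_of.symm)

theorem elt_inv {n : FreeGr} (w : n.F) : elt w⁻¹ = elt w ≫ GrpObj.inv :=
  Quiver.Hom.unop_inj (one_hom_ext rfl)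

theorem comp_elt {m n : FreeGr} (f : op m ⟶ op n) (w : n.F) :
    f ≫ elt w = elt (hom f.unop w) :=
  Quiver.Hom.unop_inj (one_hom_ext
    ((congrArg (hom f.unop) (hom_unop_elt _ _)).trans (hom_unop_elt _ _).symm))

/-- In `gr^op`, the object `n` is the `n`-th power of the object `1`. -/
def isLimitFan (n : FreeGr) :
    Limits.IsLimit (Limits.Fan.mk (op n) fun i : Fin n.rank => elt (FreeGroup.of i)) :=
  Limits.Fan.IsLimit.mk _
    (fun s => (ofHom (FreeGroup.lift fun i : Fin n.rank =>
      hom (s.proj i).unop (FreeGroup.of (0 : Fin 1)))).op)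
    (fun s i => Quiver.Hom.unop_inj (one_hom_ext
      ((congrArg (FreeGroup.lift fun i : Fin n.rank =>
        hom (s.proj i).unop (FreeGroup.of (0 : Fin 1))) (hom_unop_elt (FreeGroup.of i) 0)).trans
          FreeGroup.lift_apply_of)))
    (fun _ m h => Quiver.Hom.unop_inj (hom_ext fun i =>
      ((congrArg (hom m.unop) (hom_unop_elt (FreeGroup.of i) 0)).symm.trans
        (DFunLike.congr_fun (congrArg (fun f => hom f.unop) (h i)) _)).trans
        FreeGroup.lift_apply_of.symm))

/-- A product preserving functor on `gr^op` sends `n` to the `n`-th power of its value at `1`. -/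
noncomputable def isLimitFanMap {E : Type*} [Category* E] (H : FreeGrᵒᵖ ⥤ E)
    [Limits.PreservesFiniteProducts H] (n : FreeGr) :
    Limits.IsLimit
      (Limits.Fan.mk (H.obj (op n)) fun i : Fin n.rank => H.map (elt (FreeGroup.of i))) :=
  Limits.isLimitFanMkObjOfIsLimit H _ _ (isLimitFan n)

section

open Functor Functor.LaxMonoidal Functor.OplaxMonoidal

variable {D : Type*} [Category* D] [MonoidalCategory D] [SymmetricCategory D]
  {F G : FreeGrᵒᵖ ⥤ D} [F.Braided] [G.Braided]

attribute [local instance] Functor.diagComonObj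

/-- Morphisms of cocommutative comonoids into `G(n)` are determined by their components. -/
theorem comonHom_ext {n : FreeGr} {T : D} [ComonObj T] [IsCommComonObj T]
    (s t : T ⟶ G.obj (op n)) [IsComonHom s] [IsComonHom t]
    (h : ∀ i : Fin n.rank, s ≫ G.map (elt (FreeGroup.of i)) = t ≫ G.map (elt (FreeGroup.of i))) :
    s = t := by
  have := Limits.Fan.IsLimit.hom_ext (isLimitFanMap G.toCocommComon n)
    (A := CocommComon.of T) (CocommComon.ofHom s ‹_›) (CocommComon.ofHom t ‹_›)
    (fun i => CocommComon.hom_ext (h i))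
  exact congrArg (fun f => f.hom.hom) this

/-- The transformation `F(n) ⟶ G(n)` with all components given by `φ : F(1) ⟶ G(1)`. -/
noncomputable def extend (φ : F.obj (op one) ⟶ G.obj (op one)) [IsComonHom φ] (n : FreeGr) :
    F.toCocommComon.obj (op n) ⟶ G.toCocommComon.obj (op n) :=
  Limits.Fan.IsLimit.lift (isLimitFanMap G.toCocommComon n) fun i =>
    F.toCocommComon.map (elt (FreeGroup.of i)) ≫
      CocommComon.ofHom (A := F.toCocommComon.obj (op one)) (B := G.toCocommComon.obj (op one)) φ
        ‹_›

/-- The underlying morphism of `extend φ n`. -/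
noncomputable def extendApp (φ : F.obj (op one) ⟶ G.obj (op one)) [IsComonHom φ] (n : FreeGr) :
    F.obj (op n) ⟶ G.obj (op n) :=
  (extend φ n).hom.hom

instance (φ : F.obj (op one) ⟶ G.obj (op one)) [IsComonHom φ] (n : FreeGr) :
    IsComonHom (extendApp φ n) :=
  (extend φ n).hom.isComonHom_hom

theorem extendApp_comp_map_elt_of (φ : F.obj (op one) ⟶ G.obj (op one)) [IsComonHom φ]
    (n : FreeGr) (i : Fin n.rank) :
    extendApp φ n ≫ G.map (elt (FreeGroup.of i)) = F.map (elt (FreeGroup.of i)) ≫ φ :=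
  congrArg (fun f : F.toCocommComon.obj (op n) ⟶ G.toCocommComon.obj (op one) => f.hom.hom)
    (Limits.Fan.IsLimit.fac (isLimitFanMap G.toCocommComon n) _ i)

/-- The words `w` satisfying the equation form a subgroup containing the generators. Closure uses
that `φ` respects unit, product and inverse, and that the comonoid morphism `t` commutes with
discarding and copying. -/
theorem comp_map_elt (φ : F.obj (op one) ⟶ G.obj (op one)) [IsComonHom φ]
    (h_one : (ε F ≫ F.map MonObj.one) ≫ φ = ε G ≫ G.map MonObj.one)
    (h_mul : (μ F _ _ ≫ F.map MonObj.mul) ≫ φ = (φ ⊗ₘ φ) ≫ μ G _ _ ≫ G.map MonObj.mul)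
    (h_inv : φ ≫ G.map GrpObj.inv = F.map GrpObj.inv ≫ φ)
    {n : FreeGr} (t : F.obj (op n) ⟶ G.obj (op n)) [IsComonHom t]
    (h : ∀ i : Fin n.rank, t ≫ G.map (elt (FreeGroup.of i)) = F.map (elt (FreeGroup.of i)) ≫ φ)
    (w : n.F) : t ≫ G.map (elt w) = F.map (elt w) ≫ φ := by
  have inv (v : n.F) (hv : t ≫ G.map (elt v) = F.map (elt v) ≫ φ) :
      t ≫ G.map (elt v⁻¹) = F.map (elt v⁻¹) ≫ φ := by
    rw [elt_inv, F.map_comp, G.map_comp, reassoc_of% hv, h_inv, Category.assoc]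
  induction w using FreeGroup.induction_on with
  | C1 =>
    rw [elt_one, F.map_comp, G.map_comp, Category.assoc]
    -- Inserting the inverse pair `η`, `ε` exposes the unit of the monoid `F(1)`, so that `h_one`
    -- applies; the product case does the same with `δ` and `μ`.
    have hF : F.map MonObj.one ≫ φ = η F ≫ ε G ≫ G.map (MonObj.one (X := op one)) := by
      rw [← h_one]; simp
    have hG : G.map (MonObj.one (X := op one)) = η G ≫ ε G ≫ G.map MonObj.one := by simp
    rw [hF, hG]
    have := IsComonHom.hom_counit t
    rw [Functor.diag_counit, Functor.diag_counit] at this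
    rw [reassoc_of% this, Monoidal.ε_η_assoc]
  | of i => exact h i
  | inv_of i hi => exact inv _ hi
  | mul v w hv hw =>
    rw [elt_mul, F.map_comp, G.map_comp, Category.assoc]
    have hF : F.map MonObj.mul ≫ φ = δ F _ _ ≫ (φ ⊗ₘ φ) ≫ μ G _ _ ≫
        G.map (MonObj.mul (X := op one)) := by
      rw [← h_mul]; simp
    have hG : G.map (MonObj.mul (X := op one)) = δ G _ _ ≫ μ G _ _ ≫ G.map MonObj.mul := by simp
    rw [hF, hG, ← Category.assoc (F.map _), ← Category.assoc (G.map _), map_lift_δ, map_lift_δ,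
      Category.assoc, Category.assoc, IsComonHom.hom_comul_assoc, tensorHom_comp_tensorHom_assoc,
      tensorHom_comp_tensorHom_assoc, hv, hw, Monoidal.μ_δ_assoc]

/-- A morphism `F(1) ⟶ G(1)` compatible with the Hopf structures extends to a natural
transformation. -/
noncomputable def extendNatTrans (φ : F.obj (op one) ⟶ G.obj (op one)) [IsComonHom φ]
    (h_one : (ε F ≫ F.map MonObj.one) ≫ φ = ε G ≫ G.map MonObj.one)
    (h_mul : (μ F _ _ ≫ F.map MonObj.mul) ≫ φ = (φ ⊗ₘ φ) ≫ μ G _ _ ≫ G.map MonObj.mul)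
    (h_inv : φ ≫ G.map GrpObj.inv = F.map GrpObj.inv ≫ φ) : F ⟶ G where
  app X := extendApp φ X.unop
  naturality := by
    rintro ⟨m⟩ ⟨n⟩ f
    have : IsComonHom (F.map f) := (F.toCocommComon.map f).hom.isComonHom_hom
    have : IsComonHom (G.map f) := (G.toCocommComon.map f).hom.isComonHom_hom
    -- Both composites are comonoid morphisms, so coordinates suffice. The `i`-th coordinate after
    -- `f` is the word that is the image of the `i`-th generator.
    refine comonHom_ext (F.map f ≫ extendApp φ n) (extendApp φ m ≫ G.map f) fun i => ?_
    rw [Category.assoc, Category.assoc, extendApp_comp_map_elt_of, ← F.map_comp_assoc,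
      ← G.map_comp, comp_elt]
    exact (comp_map_elt φ h_one h_mul h_inv _ (extendApp_comp_map_elt_of φ m) _).symm

theorem extendNatTrans_app_one (φ : F.obj (op one) ⟶ G.obj (op one)) [IsComonHom φ]
    (h_one : (ε F ≫ F.map MonObj.one) ≫ φ = ε G ≫ G.map MonObj.one)
    (h_mul : (μ F _ _ ≫ F.map MonObj.mul) ≫ φ = (φ ⊗ₘ φ) ≫ μ G _ _ ≫ G.map MonObj.mul)
    (h_inv : φ ≫ G.map GrpObj.inv = F.map GrpObj.inv ≫ φ) :
    (extendNatTrans φ h_one h_mul h_inv).app (op one) = φ := by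
  have h := extendApp_comp_map_elt_of φ one (0 : Fin 1)
  have h₀ : elt (FreeGroup.of (0 : Fin 1)) = 𝟙 (op one) :=
    Quiver.Hom.unop_inj (one_hom_ext rfl)
  rw [h₀, F.map_id, G.map_id, Category.id_comp] at h
  exact (Category.comp_id _).symm.trans h

theorem isMonoidal_extendNatTrans (φ : F.obj (op one) ⟶ G.obj (op one)) [IsComonHom φ]
    (h_one : (ε F ≫ F.map MonObj.one) ≫ φ = ε G ≫ G.map MonObj.one)
    (h_mul : (μ F _ _ ≫ F.map MonObj.mul) ≫ φ = (φ ⊗ₘ φ) ≫ μ G _ _ ≫ G.map MonObj.mul)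
    (h_inv : φ ≫ G.map GrpObj.inv = F.map GrpObj.inv ≫ φ) :
    NatTrans.IsMonoidal (extendNatTrans φ h_one h_mul h_inv) :=
  Functor.isMonoidal_of_isComonHom_app _ fun X => (extend φ X.unop).hom.isComonHom_hom

/-- Monoidal transformations are determined by their component at `1`. -/
theorem monoidal_natTrans_ext (σ τ : F ⟶ G) [NatTrans.IsMonoidal σ] [NatTrans.IsMonoidal τ]
    (h : σ.app (op one) = τ.app (op one)) : σ = τ := by
  ext X
  have := Functor.isComonHom_app σ X
  have := Functor.isComonHom_app τ X
  refine comonHom_ext (n := X.unop) (T := F.obj X) _ _ (h := fun i => ?_)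
  exact (σ.naturality _).symm.trans ((congrArg (F.map _ ≫ ·) h).trans (τ.naturality _))

end

end FreeGr

/-! ### Evaluation at `1` is fully faithful -/

namespace ExpFunctor

variable {k : Type u} [CommRing k]

open scoped TensorProduct

theorem hom_ext {C : Type} [Category.{0} C] [CartesianMonoidalCategory C] [BraidedCategory C]
    {F G : ExpFunctor C k} {f g : F ⟶ G} (h : f.natTrans = g.natTrans) : f = g :=
  Hom.ext h

instance ev₁_faithful : (ev₁ k).Faithful where
  map_injective {F G f g} h := by
    refine hom_ext (FreeGr.monoidal_natTrans_ext _ _ ?_)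
    refine ModuleCat.hom_ext (LinearMap.ext fun x => ?_)
    exact DFunLike.congr_fun (congrArg HopfAlgCat.Hom.toBialgHom' h) x

/-- The linear map underlying a morphism `ev₁ F ⟶ ev₁ G`. -/
noncomputable def homOfEv₁ {F G : ExpFunctor FreeGrᵒᵖ k} (φ : (ev₁ k).obj F ⟶ (ev₁ k).obj G) :
    F.functor.obj (op FreeGr.one) ⟶ G.functor.obj (op FreeGr.one) :=
  ModuleCat.ofHom (φ.toBialgHom'.toLinearMap)

theorem isBimonHom_homOfEv₁ {F G : ExpFunctor FreeGrᵒᵖ k} (φ : (ev₁ k).obj F ⟶ (ev₁ k).obj G) :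
    letI := F.hopfObj
    letI := G.hopfObj
    IsBimonHom (homOfEv₁ φ) :=
  letI := F.hopfObj
  letI := G.hopfObj
  { one_hom := ModuleCat.hom_ext (LinearMap.ext_ring (map_one φ.toBialgHom'))
    mul_hom := ModuleCat.hom_ext (TensorProduct.ext' (map_mul φ.toBialgHom'))
    hom_counit := ModuleCat.hom_ext φ.toBialgHom'.counit_comp
    hom_comul := ModuleCat.hom_ext φ.toBialgHom'.map_comp_comul.symm }

attribute [local instance] Functor.diagComonObj

instance ev₁_full : (ev₁ k).Full where
  map_surjective {F G} φ := by
    let := F.hopfObj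
    let := G.hopfObj
    have h := isBimonHom_homOfEv₁ φ
    have h_one := h.one_hom
    have h_mul := h.mul_hom
    -- Compatibility with antipodes is automatic for bimonoid morphisms.
    have h_inv := HopfObj.hom_antipode (homOfEv₁ φ)
    have h_comon : @IsComonHom _ _ _ _ _ (F.functor.diagComonObj (op FreeGr.one))
        (G.functor.diagComonObj (op FreeGr.one)) (homOfEv₁ φ) := ⟨h.hom_counit, h.hom_comul⟩
    let τ := FreeGr.extendNatTrans (homOfEv₁ φ) h_one h_mul h_inv
    have hτ : NatTrans.IsMonoidal τ := FreeGr.isMonoidal_extendNatTrans _ _ _ _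
    refine ⟨{ natTrans := τ }, HopfAlgCat.hom_ext _ _ (DFunLike.ext _ _ fun x => ?_)⟩
    exact DFunLike.congr_fun (ModuleCat.hom_ext_iff.mp
      (FreeGr.extendNatTrans_app_one (homOfEv₁ φ) h_one h_mul h_inv)) x

end ExpFunctor

/-! ### Outer exponential functors have bicommutative values -/

namespace FreeGr

open CartesianMonoidalCategory

theorem mul_eq_elt : (MonObj.mul : op one ⊗ op one ⟶ op one) =
    elt (n := ⟨2⟩) (FreeGroup.of (0 : Fin 2) * FreeGroup.of (1 : Fin 2)) := rfl

theorem braiding_mul_eq_elt : (β_ (op one) (op one)).hom ≫ MonObj.mul =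
    elt (n := ⟨2⟩) (FreeGroup.of (1 : Fin 2) * FreeGroup.of (0 : Fin 2)) := by
  have h₀ : fst (op one) (op one) = elt (n := ⟨2⟩) (FreeGroup.of (0 : Fin 2)) :=
    Quiver.Hom.unop_inj (one_hom_ext rfl)
  have h₁ : snd (op one) (op one) = elt (n := ⟨2⟩) (FreeGroup.of (1 : Fin 2)) :=
    Quiver.Hom.unop_inj (one_hom_ext rfl)
  rw [← lift_snd_fst, h₀, h₁]
  exact (elt_mul (n := ⟨2⟩) _ _).symm

end FreeGr

namespace ExpFunctor

variable {k : Type u} [CommRing k]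

open scoped TensorProduct
open Functor.LaxMonoidal

theorem IsOuter.map_elt_conj {F : ExpFunctor FreeGrᵒᵖ k} (hF : IsOuter k F) {n : FreeGr}
    (g w : n.F) : F.functor.map (FreeGr.elt (g * w * g⁻¹)) = F.functor.map (FreeGr.elt w) := by
  have h : FreeGr.elt (g * w * g⁻¹) =
      (FreeGr.ofHom (MulAut.conj g).toMonoidHom).op ≫ FreeGr.elt w :=
    (FreeGr.comp_elt (FreeGr.ofHom (MulAut.conj g).toMonoidHom).op w).symm
  rw [h, F.functor.map_comp, hF, Category.id_comp]

theorem IsOuter.map_braiding_mul {F : ExpFunctor FreeGrᵒᵖ k} (hF : IsOuter k F) :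
    F.functor.map ((β_ (op FreeGr.one) (op FreeGr.one)).hom ≫ MonObj.mul) =
      F.functor.map MonObj.mul := by
  rw [FreeGr.braiding_mul_eq_elt, FreeGr.mul_eq_elt]
  -- Conjugating `x₁x₂` by `x₁⁻¹` gives `x₂x₁`.
  have := hF.map_elt_conj (n := ⟨2⟩) (FreeGroup.of (0 : Fin 2))⁻¹
    (FreeGroup.of (0 : Fin 2) * FreeGroup.of (1 : Fin 2))
  rw [inv_mul_cancel_left, inv_inv] at this
  exact this

theorem IsOuter.isBicommutative {F : ExpFunctor FreeGrᵒᵖ k} (hF : IsOuter k F) :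
    HopfAlgCat.IsBicommutative k ((ev₁ k).obj F) := by
  constructor
  · intro x y
    have h : (β_ (F.functor.obj (op FreeGr.one)) (F.functor.obj (op FreeGr.one))).hom ≫
        μ F.functor _ _ ≫ F.functor.map MonObj.mul =
          μ F.functor _ _ ≫ F.functor.map MonObj.mul := by
      rw [← Functor.LaxBraided.braided_assoc, ← F.functor.map_comp, hF.map_braiding_mul]
    exact LinearMap.congr_fun (ModuleCat.hom_ext_iff.mp h) (y ⊗ₜ[k] x)
  -- Cocommutativity holds for every exponential functor, outer or not.
  · exact ⟨ModuleCat.hom_ext_iff.mp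
      (Functor.isCommComonObj_obj F.functor (op FreeGr.one)).comul_comm⟩

end ExpFunctor

/-! ### Precomposition with abelianization -/

namespace abelianize

theorem map_conj {n : FreeGr} (g : n.F) :
    abelianize.map (FreeGr.ofHom (MulAut.conj g).toMonoidHom) = 𝟙 (abelianize.obj n) := by
  refine FreeAb.hom_ext fun (i : Fin n.rank) => ?_
  change Abelianization.of (g * FreeGroup.of i * g⁻¹) = Abelianization.of (FreeGroup.of i)
  rw [map_mul, map_mul, map_inv, mul_inv_cancel_comm]

/-- A homomorphism out of a free group may take any values on generators, so the images of the
generators are lifted along the surjection onto the abelianization. -/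
instance : abelianize.Full where
  map_surjective {m n} f := by
    choose w hw using fun i : Fin m.rank =>
      QuotientGroup.mk'_surjective (commutator n.F) (FreeAb.hom f (FreeAbelianGroup.of i))
    refine ⟨FreeGr.ofHom (FreeGroup.lift w), FreeAb.hom_ext fun (i : Fin m.rank) => ?_⟩
    change Abelianization.of (FreeGroup.lift w (FreeGroup.of i)) = _
    rw [FreeGroup.lift_apply_of]
    exact hw i

/-- The chosen products on both sides add ranks, so abelianization is strictly monoidal. -/
theorem δ_op (X Y : FreeGrᵒᵖ) :
    Functor.OplaxMonoidal.δ abelianize.op X Y = 𝟙 (abelianize.op.obj (X ⊗ Y)) :=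
  (Functor.OplaxMonoidal.δ_of_cartesianMonoidalCategory abelianize.op X Y).trans
    (abelianize_prodComparison X Y)

theorem μ_op (X Y : FreeGrᵒᵖ) :
    Functor.LaxMonoidal.μ abelianize.op X Y = 𝟙 (abelianize.op.obj (X ⊗ Y)) := by
  have h := Functor.Monoidal.δ_μ abelianize.op X Y
  rw [δ_op] at h
  exact (Category.id_comp _).symm.trans h

theorem ε_op : Functor.LaxMonoidal.ε abelianize.op = 𝟙 (𝟙_ FreeAbᵒᵖ) :=
  CartesianMonoidalCategory.toUnit_unique _ _

end abelianize

namespace ExpFunctor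

variable {k : Type u} [CommRing k]

theorem isOuter_abPullback (F : ExpFunctor FreeAbᵒᵖ k) : IsOuter k ((abPullback k).obj F) := by
  intro n g
  refine (congrArg (fun f => F.functor.map f.op) (abelianize.map_conj g)).trans ?_
  exact F.functor.map_id _

instance : (abPullback k).Faithful where
  map_injective {F G f g} h := by
    refine hom_ext ?_
    ext X : 2
    exact congrArg (fun f => f.natTrans.app (op ⟨X.unop.rank⟩)) h

theorem abPullback_ε (F : ExpFunctor FreeAbᵒᵖ k) :
    Functor.LaxMonoidal.ε ((abPullback k).obj F).functor = Functor.LaxMonoidal.ε F.functor :=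
  (congrArg (fun g => Functor.LaxMonoidal.ε F.functor ≫ F.functor.map g) abelianize.ε_op).trans
    ((congrArg (Functor.LaxMonoidal.ε F.functor ≫ ·) (F.functor.map_id _)).trans
      (Category.comp_id _))

theorem abPullback_μ (F : ExpFunctor FreeAbᵒᵖ k) (X Y : FreeGrᵒᵖ) :
    Functor.LaxMonoidal.μ ((abPullback k).obj F).functor X Y =
      Functor.LaxMonoidal.μ F.functor (abelianize.op.obj X) (abelianize.op.obj Y) :=
  (congrArg (fun g => Functor.LaxMonoidal.μ F.functor (abelianize.op.obj X)
    (abelianize.op.obj Y) ≫ F.functor.map g) (abelianize.μ_op X Y)).trans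
    ((congrArg (Functor.LaxMonoidal.μ F.functor (abelianize.op.obj X)
      (abelianize.op.obj Y) ≫ ·) (F.functor.map_id _)).trans (Category.comp_id _))

instance : (abPullback k).Full where
  map_surjective {F G} f := by
    let τ : F.functor ⟶ G.functor :=
      { app X := f.natTrans.app (op ⟨X.unop.rank⟩)
        naturality := by
          rintro ⟨⟨m⟩⟩ ⟨⟨n⟩⟩ g
          -- Objects coincide, so only naturality against maps of `ab` is at stake; each such map
          -- lifts to `gr`.
          obtain ⟨g', hg'⟩ := abelianize.map_surjective
            (show abelianize.obj ⟨n⟩ ⟶ abelianize.obj ⟨m⟩ from g.unop)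
          have h : g = (abelianize.map g').op := congrArg Quiver.Hom.op hg'.symm
          rw [h]
          exact f.natTrans.naturality g'.op }
    have : NatTrans.IsMonoidal τ :=
      { unit := by
          have h := NatTrans.IsMonoidal.unit (τ := f.natTrans)
          rw [abPullback_ε, abPullback_ε] at h
          exact h
        tensor := by
          rintro ⟨⟨m⟩⟩ ⟨⟨n⟩⟩
          have h := NatTrans.IsMonoidal.tensor (τ := f.natTrans) (op ⟨m⟩) (op ⟨n⟩)
          rw [abPullback_μ, abPullback_μ] at h
          exact h }
    exact ⟨{ natTrans := τ }, rfl⟩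

end ExpFunctor

/-! ### Bicommutative Hopf monoids are commutative group objects in cocommutative comonoids -/

namespace CategoryTheory.CocommComon

open scoped CategoryTheory.MonObj
open ComonObj HopfObj CartesianMonoidalCategory

variable {D : Type*} [Category* D] [MonoidalCategory D] [SymmetricCategory D]

theorem leftUnitor_hom_hom (A : CocommComon D) : (λ_ A).hom.hom.hom = (λ_ A.obj.X).hom := by
  have h : 𝟙 (𝟙_ D) ▷ A.obj.X ≫ (λ_ A.obj.X).hom = (λ_ A.obj.X).hom := by simp
  simp
  exact h

theorem rightUnitor_hom_hom (A : CocommComon D) : (ρ_ A).hom.hom.hom = (ρ_ A.obj.X).hom := by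
  have h : A.obj.X ◁ 𝟙 (𝟙_ D) ≫ (ρ_ A.obj.X).hom = (ρ_ A.obj.X).hom := by simp
  simp
  exact h

theorem associator_hom_hom (A B C : CocommComon D) :
    (α_ A B C).hom.hom.hom = (α_ A.obj.X B.obj.X C.obj.X).hom := by
  have h : 𝟙 (A.obj.X ⊗ B.obj.X) ▷ C.obj.X ≫ (α_ A.obj.X B.obj.X C.obj.X).hom ≫
      A.obj.X ◁ 𝟙 (B.obj.X ⊗ C.obj.X) = (α_ A.obj.X B.obj.X C.obj.X).hom := by simp
  simp
  exact h

variable (A : D) [HopfObj A]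

theorem isComonHom_mul : IsComonHom μ[A] where
  hom_counit := by
    rw [BimonObj.mul_counit]
  hom_comul := by
    rw [BimonObj.mul_comul, Comon.tensorObj_comul, Category.assoc]

attribute [local instance] ComonObj.instTensorUnit in
theorem isComonHom_one : IsComonHom η[A] where
  hom_counit := BimonObj.one_counit A
  hom_comul := BimonObj.one_comul A

variable [IsCommComonObj A]

/-- The antipode reverses the comultiplication; cocommutativity removes the reversal. -/
theorem isComonHom_antipode : IsComonHom 𝒮[A] where
  hom_counit := antipode_counit A
  hom_comul := by
    rw [antipode_comul, IsCommComonObj.comul_comm_assoc]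

instance : GrpObj (CocommComon.of A) where
  one := ofHom (A := 𝟙_ (CocommComon D)) η[A] (isComonHom_one A)
  mul := ofHom (A := CocommComon.of A ⊗ CocommComon.of A) μ[A] (isComonHom_mul A)
  inv := ofHom 𝒮[A] (isComonHom_antipode A)
  one_mul := hom_ext ((MonObj.one_mul A).trans (leftUnitor_hom_hom (CocommComon.of A)).symm)
  mul_one := hom_ext ((MonObj.mul_one A).trans (rightUnitor_hom_hom (CocommComon.of A)).symm)
  mul_assoc := hom_ext ((MonObj.mul_assoc A).trans
    (congrArg (· ≫ A ◁ μ[A] ≫ μ[A]) (associator_hom_hom (of A) (of A) (of A)).symm))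
  left_inv := hom_ext (by
    change (Δ[A] ≫ (𝒮[A] ⊗ₘ 𝟙 A)) ≫ μ[A] = ε[A] ≫ η[A]
    rw [tensorHom_id, Category.assoc, antipode_left])
  right_inv := hom_ext (by
    change (Δ[A] ≫ (𝟙 A ⊗ₘ 𝒮[A])) ≫ μ[A] = ε[A] ≫ η[A]
    rw [id_tensorHom, Category.assoc, antipode_right])

instance [IsCommMonObj A] : IsCommMonObj (CocommComon.of A) where
  mul_comm := hom_ext ((congrArg (· ≫ μ[A]) (braiding_hom_hom (of A) (of A))).trans
    (IsCommMonObj.mul_comm A))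

end CategoryTheory.CocommComon

/-! ### The powers of a commutative group object -/

namespace FreeAb

open scoped CategoryTheory.MonObj
open CartesianMonoidalCategory

variable {E : Type*} [Category* E] [CartesianMonoidalCategory E] [BraidedCategory E]
  (A : E) [GrpObj A] [IsCommMonObj A]

/-- The power `A^n`. -/
noncomputable abbrev pow (n : FreeAb) : E := ∏ᶜ fun _ : Fin n.rank => A

variable {A} in
/-- The homomorphism `ℤ^n → Hom(T, A)` corresponding to a morphism `T ⟶ A^n`. -/
noncomputable def evalHom {n : FreeAb} {T : E} (p : T ⟶ pow A n) :
    n.Z →+ Additive (T ⟶ A) :=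
  FreeAbelianGroup.lift fun i => Additive.ofMul (p ≫ Limits.Pi.π _ i)

theorem evalHom_of {n : FreeAb} {T : E} (p : T ⟶ pow A n) (i : Fin n.rank) :
    evalHom p (FreeAbelianGroup.of i) = Additive.ofMul (p ≫ Limits.Pi.π _ i) :=
  FreeAbelianGroup.lift_apply_of _ _

/-- Precomposition is a homomorphism between groups of points. With `evalHom_powMap` this gives
functoriality of the powers, a Yoneda argument at the universal point `𝟙 (pow A n)`. -/
theorem comp_evalHom {n : FreeAb} {T T' : E} (t : T' ⟶ T) (p : T ⟶ pow A n) (z : n.Z) :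
    t ≫ (evalHom p z).toMul = (evalHom (t ≫ p) z).toMul := by
  let c : (T ⟶ A) →* (T' ⟶ A) :=
    { toFun f := t ≫ f
      map_one' := MonObj.comp_one t
      map_mul' := MonObj.comp_mul t }
  have h : (MonoidHom.toAdditive c).comp (evalHom p) = evalHom (t ≫ p) := by
    refine FreeAbelianGroup.lift_ext _ _ fun i => ?_
    rw [AddMonoidHom.comp_apply, evalHom_of, evalHom_of]
    exact congrArg Additive.ofMul (Category.assoc _ _ _).symm
  exact congrArg Additive.toMul (DFunLike.congr_fun h z)

/-- The morphism `A^n ⟶ A^m` given by a homomorphism `ℤ^m → ℤ^n`. -/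
noncomputable def powMap {m n : FreeAb} (f : m ⟶ n) : pow A n ⟶ pow A m :=
  Limits.Pi.lift fun i => (evalHom (𝟙 (pow A n)) (hom f (FreeAbelianGroup.of i))).toMul

theorem powMap_π {m n : FreeAb} (f : m ⟶ n) (i : Fin m.rank) :
    powMap A f ≫ Limits.Pi.π _ i =
      (evalHom (𝟙 (pow A n)) (hom f (FreeAbelianGroup.of i))).toMul :=
  Limits.Pi.lift_π _ _

theorem evalHom_powMap {m n : FreeAb} (f : m ⟶ n) (z : m.Z) :
    evalHom (powMap A f) z = evalHom (𝟙 (pow A n)) (hom f z) := by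
  have h : evalHom (powMap A f) = (evalHom (𝟙 (pow A n))).comp (hom f) := by
    refine FreeAbelianGroup.lift_ext _ _ fun i => ?_
    rw [AddMonoidHom.comp_apply, evalHom_of, powMap_π]
    rfl
  exact DFunLike.congr_fun h z

/-- The product preserving functor `ab^op ⥤ E`, `n ↦ A^n`, of a commutative group object `A`. -/
noncomputable def powFunctor : FreeAbᵒᵖ ⥤ E where
  obj X := pow A X.unop
  map f := powMap A f.unop
  map_id X := by
    refine Limits.Pi.hom_ext _ _ fun i => ?_
    rw [powMap_π]
    exact congrArg Additive.toMul (evalHom_of A (𝟙 (pow A X.unop)) i)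
  map_comp {X Y Z} f g := by
    refine Limits.Pi.hom_ext _ _ fun i => ?_
    rw [Category.assoc, powMap_π, powMap_π, comp_evalHom, Category.comp_id, evalHom_powMap]
    rfl

/-- The projections of `A^n`. -/
noncomputable def powProj (X : FreeAbᵒᵖ) (i : Fin X.unop.rank) : (powFunctor A).obj X ⟶ A :=
  Limits.Pi.π _ i

variable {A} in
/-- The morphism into `A^n` given by its components. -/
noncomputable def powLift (X : FreeAbᵒᵖ) {T : E} (f : Fin X.unop.rank → (T ⟶ A)) :
    T ⟶ (powFunctor A).obj X :=
  Limits.Pi.lift f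

theorem powLift_powProj (X : FreeAbᵒᵖ) {T : E} (f : Fin X.unop.rank → (T ⟶ A))
    (i : Fin X.unop.rank) : powLift X f ≫ powProj A X i = f i :=
  Limits.Pi.lift_π _ _

variable {A} in
theorem pow_hom_ext (X : FreeAbᵒᵖ) {T : E} {f g : T ⟶ (powFunctor A).obj X}
    (h : ∀ i, f ≫ powProj A X i = g ≫ powProj A X i) : f = g :=
  Limits.Pi.hom_ext _ _ h

theorem map_powProj {X Y : FreeAbᵒᵖ} (f : X ⟶ Y) (i : Fin Y.unop.rank) :
    (powFunctor A).map f ≫ powProj A Y i =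
      (evalHom (𝟙 (pow A X.unop)) (hom f.unop (FreeAbelianGroup.of i))).toMul :=
  powMap_π A f.unop i

theorem evalHom_id_of (X : FreeAbᵒᵖ) (i : Fin X.unop.rank) :
    (evalHom (𝟙 (pow A X.unop)) (FreeAbelianGroup.of i)).toMul = powProj A X i := by
  rw [evalHom_of, Category.id_comp]
  rfl

theorem map_fst_powProj (X Y : FreeAbᵒᵖ) (i : Fin X.unop.rank) :
    (powFunctor A).map (fst X Y) ≫ powProj A X i =
      powProj A (X ⊗ Y) (Fin.castAdd Y.unop.rank i) :=
  (map_powProj A (fst X Y) i).trans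
    ((congrArg (fun z => (evalHom (𝟙 (pow A (X ⊗ Y).unop)) z).toMul)
      (FreeAbelianGroup.map_of_apply _)).trans (evalHom_id_of A (X ⊗ Y) _))

theorem map_snd_powProj (X Y : FreeAbᵒᵖ) (i : Fin Y.unop.rank) :
    (powFunctor A).map (snd X Y) ≫ powProj A Y i =
      powProj A (X ⊗ Y) (Fin.natAdd X.unop.rank i) :=
  (map_powProj A (snd X Y) i).trans
    ((congrArg (fun z => (evalHom (𝟙 (pow A (X ⊗ Y).unop)) z).toMul)
      (FreeAbelianGroup.map_of_apply _)).trans (evalHom_id_of A (X ⊗ Y) _))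

/-- The components of the inverse of the comparison morphism `A^(m+n) ⟶ A^m ⊗ A^n`. -/
noncomputable def prodComponents (X Y : FreeAbᵒᵖ) (i : Fin (X.unop.rank + Y.unop.rank)) :
    (powFunctor A).obj X ⊗ (powFunctor A).obj Y ⟶ A :=
  Fin.addCases (fun i => fst _ _ ≫ powProj A X i) (fun i => snd _ _ ≫ powProj A Y i) i

theorem prodComponents_castAdd (X Y : FreeAbᵒᵖ) (i : Fin X.unop.rank) :
    prodComponents A X Y (Fin.castAdd _ i) = fst _ _ ≫ powProj A X i :=
  Fin.addCases_left _

theorem prodComponents_natAdd (X Y : FreeAbᵒᵖ) (i : Fin Y.unop.rank) :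
    prodComponents A X Y (Fin.natAdd _ i) = snd _ _ ≫ powProj A Y i :=
  Fin.addCases_right _

instance (X Y : FreeAbᵒᵖ) : IsIso (prodComparison (powFunctor A) X Y) := by
  refine ⟨powLift (X ⊗ Y) (prodComponents A X Y), ?_, ?_⟩
  -- The proposed inverse concatenates the two families of coordinates.
  · refine pow_hom_ext (X ⊗ Y) fun (i : Fin (X.unop.rank + Y.unop.rank)) => ?_
    rw [Category.assoc, powLift_powProj, Category.id_comp]
    refine Fin.addCases (fun i => ?_) (fun i => ?_) i
    · rw [prodComponents_castAdd, prodComparison_fst_assoc, map_fst_powProj]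
    · rw [prodComponents_natAdd, prodComparison_snd_assoc, map_snd_powProj]
  · refine CartesianMonoidalCategory.hom_ext _ _ ?_ ?_
    · rw [Category.assoc, prodComparison_fst, Category.id_comp]
      refine pow_hom_ext X fun i => ?_
      rw [Category.assoc, map_fst_powProj, powLift_powProj, prodComponents_castAdd]
    · rw [Category.assoc, prodComparison_snd, Category.id_comp]
      refine pow_hom_ext Y fun i => ?_
      rw [Category.assoc, map_snd_powProj, powLift_powProj, prodComponents_natAdd]

instance : IsIso (terminalComparison (powFunctor A)) :=
  ⟨powLift (𝟙_ FreeAbᵒᵖ) (fun i : Fin 0 => i.elim0),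
    pow_hom_ext (𝟙_ FreeAbᵒᵖ) fun i : Fin 0 => i.elim0, toUnit_unique _ _⟩

instance : Limits.PreservesFiniteProducts (powFunctor A) :=
  have := preservesLimitsOfShape_discrete_walkingPair_of_isIso_prodComparison (powFunctor A)
  have := preservesLimit_empty_of_isIso_terminalComparison (powFunctor A)
  have := Limits.preservesLimitsOfShape_pempty_of_preservesTerminal (powFunctor A)
  .of_preserves_binary_and_terminal _

noncomputable instance : (powFunctor A).Braided := .ofChosenFiniteProducts _

end FreeAb

/-! ### Hopf algebras as Hopf monoids -/

namespace HopfTransport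

open scoped TensorProduct

variable {k : Type u} [CommRing k]

/-- This turns multiplicativity of the comultiplication into the bimonoid axiom. -/
theorem mul_eq_map_mul' (H : Type u) [Ring H] [Algebra k H] (s t : H ⊗[k] H) :
    s * t = TensorProduct.map (LinearMap.mul' k H) (LinearMap.mul' k H)
      ((tensorμ (ModuleCat.of k H) (ModuleCat.of k H) (ModuleCat.of k H) (ModuleCat.of k H)).hom
        (s ⊗ₜ[k] t)) := by
  induction s with
  | zero => simp
  | add x y hx hy => rw [add_mul, TensorProduct.add_tmul, map_add, map_add, hx, hy]
  | tmul a b =>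
    induction t with
    | zero => simp
    | add x y hx hy => rw [mul_add, TensorProduct.tmul_add, map_add, map_add, hx, hy]
    | tmul c d => rw [Algebra.TensorProduct.tmul_mul_tmul]; rfl

/-- A Hopf algebra over `k` is a Hopf monoid in `Mod_k` with the same structure maps. -/
noncomputable abbrev hopfObjOfHopfAlgebra (H : Type u) [Ring H] [HopfAlgebra k H] :
    HopfObj (ModuleCat.of k H) where
  __ := ModuleCat.MonModuleEquivalenceAlgebra.inverseObj (AlgCat.of k H)
  counit := ModuleCat.ofHom Coalgebra.counit
  comul := ModuleCat.ofHom Coalgebra.comul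
  counit_comul := ModuleCat.hom_ext Coalgebra.rTensor_counit_comp_comul
  comul_counit := ModuleCat.hom_ext Coalgebra.lTensor_counit_comp_comul
  comul_assoc := ModuleCat.hom_ext Coalgebra.coassoc.symm
  mul_comul := ModuleCat.hom_ext (TensorProduct.ext' fun x y =>
    (Bialgebra.comul_mul (R := k) x y).trans (mul_eq_map_mul' H _ _))
  one_comul := ModuleCat.hom_ext (LinearMap.ext_ring (by
    change Coalgebra.comul (algebraMap k H 1) = algebraMap k H 1 ⊗ₜ[k] algebraMap k H 1
    rw [map_one, Bialgebra.comul_one, Algebra.TensorProduct.one_def]))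
  mul_counit := ModuleCat.hom_ext (TensorProduct.ext' fun x y => Bialgebra.counit_mul x y)
  one_counit := ModuleCat.hom_ext (LinearMap.ext_ring (by
    change Coalgebra.counit (algebraMap k H 1) = (1 : k)
    rw [map_one, Bialgebra.counit_one]))
  antipode := ModuleCat.ofHom (HopfAlgebra.antipode k)
  antipode_left := ModuleCat.hom_ext HopfAlgebra.mul_antipode_rTensor_comul
  antipode_right := ModuleCat.hom_ext HopfAlgebra.mul_antipode_lTensor_comul

end HopfTransport

/-! ### The exponential functor of a bicommutative Hopf algebra -/

namespace CategoryTheory.Functor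

open CartesianMonoidalCategory OplaxMonoidal

variable {C : Type*} [Category* C] [CartesianMonoidalCategory C] [BraidedCategory C]
  {D : Type*} [Category* D] [MonoidalCategory D] [SymmetricCategory D]

/-- A functor respecting products carries diagonals to diagonals, and the diagonal of a
cocommutative comonoid is its own comultiplication. Hence the comultiplication induced by `K ⋙
CocommComon.forget D` is the original one. -/
theorem map_diag_δ_comp_forget (K : C ⥤ CocommComon D) [K.Braided] (X : C) :
    (K ⋙ CocommComon.forget D).map (lift (𝟙 X) (𝟙 X)) ≫ δ (K ⋙ CocommComon.forget D) X X =
      ComonObj.comul (X := (K.obj X).obj.X) := by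
  have h : (K ⋙ CocommComon.forget D).map (lift (𝟙 X) (𝟙 X)) ≫
      δ (K ⋙ CocommComon.forget D) X X =
        (CocommComon.forget D).map (K.map (lift (𝟙 X) (𝟙 X)) ≫ δ K X X) := by
    rw [OplaxMonoidal.comp_δ, CocommComon.forget_δ, Functor.map_comp]
    exact congrArg (_ ≫ ·) (Category.comp_id _)
  rw [h, lift_δ, K.map_id]
  change ComonObj.comul (X := (K.obj X).obj.X) ≫ (𝟙 _ ⊗ₘ 𝟙 _) = _
  rw [id_tensorHom_id, Category.comp_id]

theorem map_toUnit_η_comp_forget (K : C ⥤ CocommComon D) [K.Braided] (X : C) :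
    (K ⋙ CocommComon.forget D).map (toUnit X) ≫ η (K ⋙ CocommComon.forget D) =
      ComonObj.counit (X := (K.obj X).obj.X) := by
  have h : (K ⋙ CocommComon.forget D).map (toUnit X) ≫ η (K ⋙ CocommComon.forget D) =
      (CocommComon.forget D).map (K.map (toUnit X) ≫ η K) := by
    rw [OplaxMonoidal.comp_η, CocommComon.forget_η, Functor.map_comp]
    exact congrArg (_ ≫ ·) (Category.comp_id _)
  rw [h, toUnit_unique (K.map (toUnit X) ≫ η K) (toUnit _)]
  rfl

end CategoryTheory.Functor

/-! ### The structure maps of the first power of a commutative group object -/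

namespace FreeAb

open CartesianMonoidalCategory
open scoped CategoryTheory.MonObj

variable {E : Type*} [Category* E] [CartesianMonoidalCategory E] [BraidedCategory E]
  (A : E) [GrpObj A] [IsCommMonObj A]

/-- The isomorphism `A^1 ≅ A`. -/
noncomputable def powOneIso : (powFunctor A).obj (op ⟨1⟩) ≅ A where
  hom := powProj A (op ⟨1⟩) (0 : Fin 1)
  inv := powLift (op ⟨1⟩) fun _ => 𝟙 A
  hom_inv_id := pow_hom_ext _ fun i => by
    rw [Category.assoc, powLift_powProj, Category.comp_id, Category.id_comp,
      Subsingleton.elim (α := Fin 1) i 0]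
  inv_hom_id := powLift_powProj A _ _ _

theorem map_unit_powProj :
    (powFunctor A).map (abelianize.op.map FreeGr.unit) ≫ powProj A (op ⟨1⟩) (0 : Fin 1) =
      toUnit _ ≫ η[A] := by
  refine (map_powProj A _ _).trans ?_
  exact congrArg Additive.toMul (map_zero (evalHom (𝟙 (pow A ⟨0⟩))))

theorem map_nabla_powProj :
    (powFunctor A).map (abelianize.op.map FreeGr.nabla) ≫ powProj A (op ⟨1⟩) (0 : Fin 1) =
      lift (powProj A (op ⟨2⟩) (0 : Fin 2)) (powProj A (op ⟨2⟩) (1 : Fin 2)) ≫ μ[A] := by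
  refine (map_powProj A _ _).trans ?_
  refine (congrArg Additive.toMul (map_add (evalHom (𝟙 (pow A ⟨2⟩)))
    (FreeAbelianGroup.of (0 : Fin 2)) (FreeAbelianGroup.of (1 : Fin 2)))).trans ?_
  exact congrArg₂ (fun f g => lift f g ≫ μ[A]) (evalHom_id_of A (op ⟨2⟩) (0 : Fin 2))
    (evalHom_id_of A (op ⟨2⟩) (1 : Fin 2))

theorem ε_map_unit_powProj :
    Functor.LaxMonoidal.ε (powFunctor A) ≫ (powFunctor A).map (abelianize.op.map FreeGr.unit) ≫
      powProj A (op ⟨1⟩) (0 : Fin 1) = η[A] :=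
  (congrArg (Functor.LaxMonoidal.ε (powFunctor A) ≫ ·) (map_unit_powProj A)).trans
    ((Category.assoc _ _ _).symm.trans
      ((congrArg (· ≫ η[A]) (toUnit_unique _ (𝟙 _))).trans (Category.id_comp _)))

theorem μ_map_nabla_powProj :
    Functor.LaxMonoidal.μ (powFunctor A) (op ⟨1⟩) (op ⟨1⟩) ≫
      (powFunctor A).map (abelianize.op.map FreeGr.nabla) ≫ powProj A (op ⟨1⟩) (0 : Fin 1) =
    (powProj A (op ⟨1⟩) (0 : Fin 1) ⊗ₘ powProj A (op ⟨1⟩) (0 : Fin 1)) ≫ μ[A] := by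
  -- With `2 = 1 + 1`, the two coordinates of `A^2` are the single coordinates of its two factors.
  have h₀ : powProj A (op ⟨2⟩) (0 : Fin 2) = (powFunctor A).map (fst (op ⟨1⟩) (op ⟨1⟩)) ≫
      powProj A (op ⟨1⟩) (0 : Fin 1) :=
    (map_fst_powProj A (op ⟨1⟩) (op ⟨1⟩) (0 : Fin 1)).symm
  have h₁ : powProj A (op ⟨2⟩) (1 : Fin 2) = (powFunctor A).map (snd (op ⟨1⟩) (op ⟨1⟩)) ≫
      powProj A (op ⟨1⟩) (0 : Fin 1) :=
    (map_snd_powProj A (op ⟨1⟩) (op ⟨1⟩) (0 : Fin 1)).symm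
  refine (congrArg (Functor.LaxMonoidal.μ (powFunctor A) (op ⟨1⟩) (op ⟨1⟩) ≫ ·)
    (map_nabla_powProj A)).trans ?_
  rw [h₀, h₁]
  refine (Category.assoc _ _ _).symm.trans (congrArg (· ≫ μ[A]) ?_)
  refine (comp_lift _ _ _).trans ?_
  rw [Functor.Monoidal.μ_fst_assoc, Functor.Monoidal.μ_snd_assoc, lift_fst_comp_snd_comp]

end FreeAb

namespace CategoryTheory.Functor

variable {C : Type*} [Category* C] [MonoidalCategory C]
  {D : Type*} [Category* D] [MonoidalCategory D] [SymmetricCategory D]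

theorem ε_comp_forget (K : C ⥤ CocommComon D) [K.Monoidal] :
    LaxMonoidal.ε (K ⋙ CocommComon.forget D) = (LaxMonoidal.ε K).hom.hom :=
  (congrArg (· ≫ (LaxMonoidal.ε K).hom.hom) CocommComon.forget_ε).trans (Category.id_comp _)

theorem μ_comp_forget (K : C ⥤ CocommComon D) [K.Monoidal] (X Y : C) :
    LaxMonoidal.μ (K ⋙ CocommComon.forget D) X Y = (LaxMonoidal.μ K X Y).hom.hom :=
  (congrArg (· ≫ (LaxMonoidal.μ K X Y).hom.hom) (CocommComon.forget_μ _ _)).trans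
    (Category.id_comp _)

end CategoryTheory.Functor

namespace ExpFunctor

open CartesianMonoidalCategory Functor

variable {k : Type u} [CommRing k]

theorem abPullback_map_diag_δ (F : ExpFunctor FreeAbᵒᵖ k) (X : FreeGrᵒᵖ) :
    ((abPullback k).obj F).functor.map (lift (𝟙 X) (𝟙 X)) ≫
        OplaxMonoidal.δ ((abPullback k).obj F).functor X X =
      F.functor.map (lift (𝟙 (abelianize.op.obj X)) (𝟙 (abelianize.op.obj X))) ≫
        OplaxMonoidal.δ F.functor (abelianize.op.obj X) (abelianize.op.obj X) := by
  change F.functor.map (abelianize.op.map (lift (𝟙 X) (𝟙 X))) ≫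
    F.functor.map (OplaxMonoidal.δ abelianize.op X X) ≫ OplaxMonoidal.δ F.functor _ _ = _
  rw [← F.functor.map_comp_assoc, OplaxMonoidal.lift_δ, abelianize.op.map_id]

theorem abPullback_map_toUnit_η (F : ExpFunctor FreeAbᵒᵖ k) (X : FreeGrᵒᵖ) :
    ((abPullback k).obj F).functor.map (toUnit X) ≫
        OplaxMonoidal.η ((abPullback k).obj F).functor =
      F.functor.map (toUnit (abelianize.op.obj X)) ≫ OplaxMonoidal.η F.functor := by
  change F.functor.map (abelianize.op.map (toUnit X)) ≫
    F.functor.map (OplaxMonoidal.η abelianize.op) ≫ OplaxMonoidal.η F.functor = _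
  rw [← F.functor.map_comp_assoc]
  exact congrArg (fun f => F.functor.map f ≫ OplaxMonoidal.η F.functor) (toUnit_unique _ _)

section

variable (A : ModuleCat.{u} k) [HopfObj A] [IsCommComonObj A] [IsCommMonObj A]

/-- The exponential `ab^op`-module `n ↦ A^{⊗ n}` of a bicommutative Hopf monoid `A`. -/
noncomputable def ofHopfObj : ExpFunctor FreeAbᵒᵖ k where
  functor := FreeAb.powFunctor (CocommComon.of A) ⋙ CocommComon.forget _

/-- The isomorphism of modules from the value at `1` of `ofHopfObj A` to `A`. -/
noncomputable def ofHopfObjOneIso :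
    ((abPullback k).obj (ofHopfObj A)).functor.obj (op FreeGr.one) ≅ A :=
  (CocommComon.forget _).mapIso (FreeAb.powOneIso (CocommComon.of A))

/-- Unit and product are computed in cocommutative comonoids and then forgotten; counit and
comultiplication are respected because `powOneIso` is an isomorphism of comonoids. -/
theorem isBimonHom_ofHopfObjOneIso_hom :
    letI := ((abPullback k).obj (ofHopfObj A)).hopfObj
    IsBimonHom (ofHopfObjOneIso A).hom :=
  letI := ((abPullback k).obj (ofHopfObj A)).hopfObj
  { one_hom := by
      change (LaxMonoidal.ε ((abPullback k).obj (ofHopfObj A)).functor ≫ _) ≫ _ = _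
      rw [abPullback_ε]
      change (LaxMonoidal.ε (FreeAb.powFunctor (CocommComon.of A) ⋙ CocommComon.forget _) ≫ _) ≫ _
        = _
      rw [ε_comp_forget]
      exact (Category.assoc _ _ _).trans
        (congrArg (fun f => f.hom.hom) (FreeAb.ε_map_unit_powProj (CocommComon.of A)))
    mul_hom := by
      change (LaxMonoidal.μ ((abPullback k).obj (ofHopfObj A)).functor _ _ ≫ _) ≫ _ = _
      rw [abPullback_μ]
      change (LaxMonoidal.μ (FreeAb.powFunctor (CocommComon.of A) ⋙ CocommComon.forget _) _ _ ≫ _)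
        ≫ _ = _
      rw [μ_comp_forget]
      exact (Category.assoc _ _ _).trans
        (congrArg (fun f => f.hom.hom) (FreeAb.μ_map_nabla_powProj (CocommComon.of A)))
    hom_counit := by
      refine Eq.trans ?_ ((abPullback_map_toUnit_η (ofHopfObj A) _).trans
        (map_toUnit_η_comp_forget (FreeAb.powFunctor (CocommComon.of A)) _)).symm
      exact (FreeAb.powOneIso (CocommComon.of A)).hom.hom.isComonHom_hom.hom_counit
    hom_comul := by
      refine Eq.trans ?_ (congrArg (· ≫ _) ((abPullback_map_diag_δ (ofHopfObj A) _).trans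
        (map_diag_δ_comp_forget (FreeAb.powFunctor (CocommComon.of A)) _)).symm)
      exact (FreeAb.powOneIso (CocommComon.of A)).hom.hom.isComonHom_hom.hom_comul }

end

end ExpFunctor

/-! ### Realizing a bicommutative Hopf algebra as a value at `1` -/

namespace HopfAlgCat.IsBicommutative

open HopfTransport
open scoped TensorProduct

variable {k : Type u} [CommRing k] {H : HopfAlgCat.{u} k}

attribute [local instance] hopfObjOfHopfAlgebra

theorem isCommComonObj (hH : IsBicommutative k H) : IsCommComonObj (ModuleCat.of k H) :=
  have := hH.2
  ⟨ModuleCat.hom_ext (Coalgebra.comm_comp_comul k H)⟩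

theorem isCommMonObj (hH : IsBicommutative k H) : IsCommMonObj (ModuleCat.of k H) :=
  ⟨ModuleCat.hom_ext (TensorProduct.ext' fun x y => hH.1 y x)⟩

variable (hH : IsBicommutative k H)

/-- The exponential `ab^op`-module `n ↦ H^{⊗ n}` of a bicommutative Hopf algebra `H`. -/
noncomputable def toExpFunctor : ExpFunctor FreeAbᵒᵖ k :=
  have := hH.isCommComonObj
  have := hH.isCommMonObj
  ExpFunctor.ofHopfObj (ModuleCat.of k H)

/-- The homomorphism of Hopf algebras from the value at `1` of `n ↦ H^{⊗ n}` to `H`. -/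
noncomputable def ev₁Hom :
    ((ExpFunctor.abPullback k).obj hH.toExpFunctor).ev₁Obj →ₐc[k] H :=
  have := hH.isCommComonObj
  have := hH.isCommMonObj
  letI := ((ExpFunctor.abPullback k).obj (ExpFunctor.ofHopfObj (ModuleCat.of k H))).hopfObj
  let f := (ExpFunctor.ofHopfObjOneIso (ModuleCat.of k H)).hom
  have : IsBimonHom f := ExpFunctor.isBimonHom_ofHopfObjOneIso_hom (ModuleCat.of k H)
  { f.hom with
    counit_comp := ModuleCat.hom_ext_iff.mp (IsComonHom.hom_counit f)
    map_comp_comul := ModuleCat.hom_ext_iff.mp (IsComonHom.hom_comul f).symm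
    -- The unit of the Hopf monoid is `algebraMap k H`, which still has to be evaluated at `1`.
    map_one' := (LinearMap.congr_fun (ModuleCat.hom_ext_iff.mp (IsMonHom.one_hom f)) (1 : k)).trans
      (map_one (algebraMap k H))
    map_mul' := fun x y => LinearMap.congr_fun (ModuleCat.hom_ext_iff.mp
      (IsMonHom.mul_hom f)) (x ⊗ₜ[k] y) }

theorem bijective_ev₁Hom : Function.Bijective hH.ev₁Hom :=
  have := hH.isCommComonObj
  have := hH.isCommMonObj
  (ExpFunctor.ofHopfObjOneIso (ModuleCat.of k H)).toLinearEquiv.bijective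

/-- Every bicommutative Hopf algebra `H` is the value at `1` of the functor `n ↦ H^{⊗ n}`. -/
noncomputable def ev₁Iso :
    (ExpFunctor.ev₁ k).obj ((ExpFunctor.abPullback k).obj hH.toExpFunctor) ≅ H :=
  (BialgEquiv.ofBijective hH.ev₁Hom hH.bijective_ev₁Hom).toHopfAlgIso

end HopfAlgCat.IsBicommutative

theorem theorem202207311733 (k : Type u) [CommRing k] :
    (∃ h : ∀ F : ExpFunctor FreeAbᵒᵖ k,
        ExpFunctor.IsOuter k ((ExpFunctor.abPullback k).obj F),
      ((ExpFunctor.IsOuter k).lift (ExpFunctor.abPullback k) h).IsEquivalence) ∧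
    (∃ h : ∀ F : (ExpFunctor.IsOuter k).FullSubcategory,
        HopfAlgCat.IsBicommutative k (((ExpFunctor.IsOuter k).ι ⋙ ExpFunctor.ev₁ k).obj F),
      ((HopfAlgCat.IsBicommutative k).lift
        ((ExpFunctor.IsOuter k).ι ⋙ ExpFunctor.ev₁ k) h).IsEquivalence) := by
  refine ⟨⟨ExpFunctor.isOuter_abPullback, ?_⟩,
    ⟨fun F => ExpFunctor.IsOuter.isBicommutative F.property, ?_⟩⟩
  · exact
      -- The functor built from `ev₁ F` has the same value at `1` as `F`; full faithfulness of `ev₁`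
      -- lifts this Hopf isomorphism to one of exponential functors.
      { essSurj := ⟨fun F =>
          let h := ExpFunctor.IsOuter.isBicommutative F.property
          ⟨h.toExpFunctor, ⟨ObjectProperty.isoMk _ ((ExpFunctor.ev₁ k).preimageIso h.ev₁Iso)⟩⟩⟩ }
  · exact
      { essSurj := ⟨fun H =>
          ⟨⟨(ExpFunctor.abPullback k).obj H.property.toExpFunctor,
            ExpFunctor.isOuter_abPullback _⟩, ⟨ObjectProperty.isoMk _ H.property.ev₁Iso⟩⟩⟩ }
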